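/- Work in $L^2(\mathbb R)$ with $\langle f,g\rangle=\int\overline f\,g\,dx$. On the Schwartz space $\mathcal S(\mathbb R)$ let $(xf)(x)=x f(x)$, $p=-i\,\frac{d}{dx}$ and $a=\frac{1}{\sqrt2}(x+ip)$, let $a^\dagger$ be the Hilbert space adjoint of $a$, and let products of unbounded operators have their natural domains. Let $H_n$ be the (physicists') Hermite polynomials, $H_0=1$, $H_{n+1}(x)=2xH_n(x)-H_n'(x)$, and let $e_n(x)=\frac{\pi^{-1/4}}{\sqrt{2^n n!}}H_n(x)e^{-x^2/2}$. For $\theta\in(-\frac\pi4,\frac\pi4)\setminus\{0\}$ put $$A_\theta=\cos\theta\,a+i\sin\theta\,a^\dagger,\qquad B_\theta=\cos\theta\,a^\dagger+i\sin\theta\,a,\qquad H_\theta=\tfrac12(p^2+x^2)-\tfrac i2\tan(2\theta)(p^2-x^2),$$ $$T_\theta=e^{\,i\frac\theta2\,(a^2-a^{\dagger 2})},$$ where the exponential $e^K$ of an unbounded operator $K$ is the closure of the operator $f\mapsto\sum_n\frac1{n!}K^nf$ defined on the vectors $f\in\bigcap_nD(K^n)$ with $\sum_n\frac1{n!}\|K^nf\|<\infty$.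 Let $N_1,N_2\in\mathbb C$ satisfy $\overline{N_1}N_2=\frac{e^{-i\theta}}{\sqrt\pi}$ and let $$\varphi_n(x)=\frac{N_1}{\sqrt{2^n n!}}H_n(e^{i\theta}x)\,e^{-\frac12e^{2i\theta}x^2},\qquad \Psi_n(x)=\frac{N_2}{\sqrt{2^n n!}}H_n(e^{-i\theta}x)\,e^{-\frac12e^{-2i\theta}x^2}\qquad(n\ge 0).$$ Then: 1. $A_\theta$ and $B_\theta$ act on $\mathcal S(\mathbb R)$ as $\frac1{\sqrt2}\left(e^{i\theta}x\pm e^{-i\theta}\frac{d}{dx}\right)$ (sign $+$ for $A_\theta$, $-$ for $B_\theta$), $[A_\theta,B_\theta]=1$ on $\mathcal S(\mathbb R)$, and $H_\theta=\frac{1}{\cos2\theta}\left(B_\theta A_\theta+\frac12\right)$. 2. All $\varphi_n,\Psi_n,e_n$ belong to $\mathcal S(\mathbb R)$, and $(e_n)_{n\ge0}$ is an orthonormal basis of $L^2(\mathbb R)$. Moreover $A_\theta\varphi_0=0$, $B_\theta^\dagger\Psi_0=0$, $\varphi_n=\frac1{\sqrt{n!}}B_\theta^n\varphi_0$, $\Psi_n=\frac1{\sqrt{n!}}(A_\theta^\dagger)^n\Psi_0$,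 $B_\theta A_\theta\varphi_n=n\varphi_n$ and $A_\theta^\dagger B_\theta^\dagger\Psi_n=n\Psi_n$. The eigenvectors of $H_\theta$ are exactly the nonzero multiples of the $\varphi_n$, and those of $H_\theta^\dagger$ exactly the nonzero multiples of the $\Psi_n$, in both cases with eigenvalue $\frac{n+1/2}{\cos2\theta}$. 3. The two families are biorthogonal, $\langle\varphi_n,\Psi_m\rangle=\delta_{n,m}$, and each of them is complete in $L^2(\mathbb R)$, i.e. has dense linear span. 4. $T_\theta$ is self-adjoint and invertible (injective with densely defined inverse), and both $T_\theta$ and $T_\theta^{-1}$ are unbounded. On the linear span of all $e_n$ and all $\varphi_n$ one has $A_\theta=T_\theta aT_\theta^{-1}$ and $B_\theta=T_\theta a^\dagger T_\theta^{-1}$. There is a single constant $\alpha\in\mathbb C\setminus\{0\}$ such that for all $n$ $$\varphi_n=\alpha\,T_\theta e_n,\qquad \Psi_n=\frac1{\overline\alpha}\,T_\theta^{-1}e_n .$$ 5. Neither $(\varphi_n)$ nor $(\Psi_n)$ is a Riesz basis, i.e. the image of an orthonormal basis of $L^2(\mathbb R)$ under a bounded operator with bounded inverse. -/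

import Mathlib

open scoped SchwartzMap

noncomputable section

namespace Swanson

/-- The Hilbert space `L²(ℝ)`. Its inner product is conjugate linear in the first variable. -/
abbrev L2 : Type := MeasureTheory.Lp ℂ 2 (MeasureTheory.volume : MeasureTheory.Measure ℝ)

/-- A Schwartz function, seen as a vector of `L²(ℝ)`. -/
def toL2 : 𝓢(ℝ, ℂ) →ₗ[ℂ] L2 := (SchwartzMap.toLpCLM ℂ ℂ 2 MeasureTheory.volume).toLinearMap

theorem toL2_injective : Function.Injective toL2 :=
  SchwartzMap.injective_toLp 2 MeasureTheory.volume

/-! ### Unbounded operators -/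

section Operators

variable {E : Type*} [NormedAddCommGroup E] [InnerProductSpace ℂ E]

/-- The identity operator, defined everywhere. -/
def opOne : E →ₗ.[ℂ] E := (LinearMap.id : E →ₗ[ℂ] E).toPMap ⊤

/-- The product `S T` of two unbounded operators on its natural domain
`{x ∈ D(T) : T x ∈ D(S)}`. -/
def opMul (S T : E →ₗ.[ℂ] E) : E →ₗ.[ℂ] E :=
  S.comp (T.domRestrict ((S.domain.comap T.toFun).map T.domain.subtype)) (by
    rintro ⟨x, hx⟩
    obtain ⟨⟨y, hy, rfl⟩, -⟩ := Submodule.mem_inf.1 hx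
    exact hy)

/-- The powers `T ^ n` of an unbounded operator on their natural domains. -/
def opPow (T : E →ₗ.[ℂ] E) : ℕ → (E →ₗ.[ℂ] E)
  | 0 => opOne
  | n + 1 => opMul T (opPow T n)

/-- The graph of the exponential series of `K`: the pairs `(x, y)` such that `x` belongs to the
domain of every power of `K`, `∑ ‖K ^ n x‖ / n!` is finite, and `y = ∑ (K ^ n x) / n!`. -/
def expGraph (K : E →ₗ.[ℂ] E) : Submodule ℂ (E × E) where
  carrier := {p | ∃ u : ℕ → E, (∀ n, (p.1, u n) ∈ (opPow K n).graph) ∧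
    Summable (fun n => ‖u n‖ / (n.factorial : ℝ)) ∧
    HasSum (fun n => ((n.factorial : ℂ))⁻¹ • u n) p.2}
  zero_mem' := ⟨0, fun n => (opPow K n).graph.zero_mem, by simp [summable_zero], by
    simp [hasSum_zero]⟩
  add_mem' := by
    rintro p q ⟨u, hu, hu1, hu2⟩ ⟨v, hv, hv1, hv2⟩
    refine ⟨u + v, fun n => (opPow K n).graph.add_mem (hu n) (hv n), ?_, ?_⟩
    · refine Summable.of_nonneg_of_le (fun n => by positivity) (fun n => ?_) (hu1.add hv1)
      rw [← add_div]
      gcongr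
      exact norm_add_le _ _
    · simpa [smul_add] using hu2.add hv2
  smul_mem' := by
    rintro c p ⟨u, hu, hu1, hu2⟩
    refine ⟨c • u, fun n => (opPow K n).graph.smul_mem c (hu n), ?_, ?_⟩
    · simpa [norm_smul, mul_div_assoc] using hu1.mul_left ‖c‖
    · simpa [smul_comm c] using hu2.const_smul c

/-- The exponential series is single valued. -/
theorem expGraph_single_valued (K : E →ₗ.[ℂ] E) :
    ∀ p ∈ expGraph K, p.1 = 0 → p.2 = 0 := by
  rintro ⟨x, y⟩ ⟨u, hu, -, hy⟩ hx
  have hx' : x = 0 := hx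
  subst hx'
  have h0 : ∀ n, u n = 0 := fun n => (opPow K n).graph_fst_eq_zero_snd (hu n) rfl
  simp only [h0, smul_zero] at hy
  exact hy.unique hasSum_zero

/-- The operator exponential `e ^ K`: the closure of the operator `x ↦ ∑ (K ^ n x) / n!`, defined on
the vectors for which the series makes sense and converges absolutely. If `K` has a self-adjoint
closure, this operator is a restriction of the exponential of that closure given by the spectral
theorem, and hence equal to it as soon as it is self-adjoint. -/
def opExp (K : E →ₗ.[ℂ] E) : E →ₗ.[ℂ] E := (expGraph K).toLinearPMap.closure

/-- `T` is a bounded operator (on its domain). -/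
def IsBoundedOp (T : E →ₗ.[ℂ] E) : Prop := ∃ C : ℝ, ∀ x : T.domain, ‖T x‖ ≤ C * ‖(x : E)‖

/-- A Riesz basis: the image of an orthonormal basis under a bounded operator with bounded
inverse. -/
def IsRieszBasis (f : ℕ → E) : Prop :=
  ∃ (e : HilbertBasis ℕ ℂ E) (V : E ≃L[ℂ] E), ∀ n, f n = V (e n)

/-- `f` is complete: its linear span is dense. -/
def IsCompleteFamily (f : ℕ → E) : Prop :=
  Dense (Submodule.span ℂ (Set.range f) : Set E)

end Operators

/-! ### The operators of the model -/

/-- The dense subspace `𝓢(ℝ)` of `L²(ℝ)`. -/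
def schwartzSpace : Submodule ℂ L2 := LinearMap.range toL2

/-- A linear endomorphism of `𝓢(ℝ)`, seen as an unbounded operator on `L²(ℝ)` with domain
`𝓢(ℝ)`. -/
def ofSchwartz (L : 𝓢(ℝ, ℂ) →ₗ[ℂ] 𝓢(ℝ, ℂ)) : L2 →ₗ.[ℂ] L2 where
  domain := schwartzSpace
  toFun := toL2 ∘ₗ L ∘ₗ (LinearEquiv.ofInjective toL2 toL2_injective).symm.toLinearMap

/-- The position operator `x`, on `𝓢(ℝ)`. -/
def opX : L2 →ₗ.[ℂ] L2 :=
  ofSchwartz (SchwartzMap.smulLeftCLM ℂ (fun x : ℝ => (x : ℂ))).toLinearMap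

/-- The momentum operator `p = -i d/dx`, on `𝓢(ℝ)`. -/
def opP : L2 →ₗ.[ℂ] L2 :=
  ofSchwartz (-Complex.I • (SchwartzMap.derivCLM ℂ ℂ).toLinearMap)

/-- The annihilation operator `a = (x + i p) / √2`. -/
def opa : L2 →ₗ.[ℂ] L2 := ((Real.sqrt 2 : ℂ)⁻¹) • (opX + Complex.I • opP)

/-- The creation operator `a†`, the Hilbert space adjoint of `a`. -/
def opadag : L2 →ₗ.[ℂ] L2 := opa.adjoint

/-- `A_θ = cos θ a + i sin θ a†`. -/
def opA (θ : ℝ) : L2 →ₗ.[ℂ] L2 :=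
  (Real.cos θ : ℂ) • opa + (Complex.I * (Real.sin θ : ℂ)) • opadag

/-- `B_θ = cos θ a† + i sin θ a`. -/
def opB (θ : ℝ) : L2 →ₗ.[ℂ] L2 :=
  (Real.cos θ : ℂ) • opadag + (Complex.I * (Real.sin θ : ℂ)) • opa

/-- The Swanson hamiltonian `H_θ = (p² + x²) / 2 - (i / 2) tan (2θ) (p² - x²)`. -/
def opH (θ : ℝ) : L2 →ₗ.[ℂ] L2 :=
  (1 / 2 : ℂ) • (opMul opP opP + opMul opX opX)
    - (Complex.I / 2 * (Real.tan (2 * θ) : ℂ)) • (opMul opP opP - opMul opX opX)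

/-- `T_θ = exp (i (θ / 2) (a² - a†²))`. -/
def opT (θ : ℝ) : L2 →ₗ.[ℂ] L2 :=
  opExp ((Complex.I * (θ : ℂ) / 2) • (opMul opa opa - opMul opadag opadag))

/-- The (physicists') Hermite polynomials: `H₀ = 1`, `Hₙ₊₁ = 2 X Hₙ - Hₙ'`. -/
def hermiteH : ℕ → Polynomial ℂ
  | 0 => 1
  | n + 1 => 2 * Polynomial.X * hermiteH n - Polynomial.derivative (hermiteH n)

/-- The function `x ↦ N / √(2ⁿ n!) Hₙ(e^{iθ} x) exp(-e^{2iθ} x² / 2)`. -/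
def hermiteFun (θ : ℝ) (N : ℂ) (n : ℕ) (x : ℝ) : ℂ :=
  N / (Real.sqrt (2 ^ n * n.factorial) : ℂ)
    * (hermiteH n).eval (Complex.exp (Complex.I * θ) * x)
    * Complex.exp (-(Complex.exp (2 * Complex.I * θ) * (x : ℂ) ^ 2) / 2)

end Swanson

end

/-!
On Schwartz functions the exponent of `T_θ` is `iθ D`, where `D = x d/dx + 1/2` generates the
dilations `f(x) ↦ e^{t/2} f(e^t x)`. So `T_θ` is the dilation by the complex factor `e^{iθ}`, and it
takes the Hermite function `eₙ` to a multiple of `φₙ(x) ∝ Hₙ(e^{iθ} x) exp(-e^{2iθ} x² / 2)`. The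
work is to make this true for the closure of the exponential series, and to show that `T_θ` is
self-adjoint.

*Analytic vectors.* For a polynomial `P`, the orbit `ζ ↦ e^{ζD} (P e^{-x²/2})` of complex dilations
is holomorphic with values in `L²(ℝ)` on the strip `|Im ζ| < π/4`, where the Gaussian factor stays
square integrable (`hasDerivAt_toL2_dilGauss`). Its Taylor series at `0` is the exponential series,
which therefore converges absolutely at `ζ = iθ` to the dilated function (`mem_expGraph_dilGauss`).

*Self-adjointness.* The series of a symmetric operator is symmetric, so `T_θ` is closed and
symmetric, and it suffices that `T_θ ± i` have dense range on the vectors `P e^{-x²/2}`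
(`mem_graph_of_inner_eq`, `isSelfAdjoint_of_core`). If `g` is orthogonal to such a range, then `h(ζ)
= ⟪g, e^{ζD} (P e^{-x²/2})⟫` satisfies `h(ζ + iθ) = ± i h(ζ)`. Since real dilations are unitary, `h`
is bounded on closed substrips, so it extends to a bounded entire function; by Liouville's theorem
it is constant, and then zero because the phase is not `1` (`eq_zero_of_quasiperiodic`). The same
density shows that the weak equations `⟪T_θ eₘ, g⟫ = ⟪eₘ, h⟫` imply `T_θ g = h`; with
biorthogonality this yields that `T_θ Ψₙ` is a multiple of `eₙ` (`mem_opT_graph_of_inner`).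

*Ladder operators.* `A_θ` and `B_θ` are first order operators on `𝓢(ℝ)` (`opA_eq`, `opB_eq`), whose
formal adjoints are `B_{-θ}` and `A_{-θ}`. All ladder relations are identities for Hermite
polynomials, and biorthogonality follows from them. Each family is total: a function orthogonal to
all polynomials times a Gaussian has, multiplied by the Gaussian, vanishing Fourier transform
(`eq_zero_of_inner_gaussS`). A biorthogonal total family of eigenvectors of the adjoint excludes any
further eigenvector (`mem_graph_smul_iff_of_biorthogonal`).

*Growth.* The ladder relations show that `‖φₙ‖²` satisfies the recursion of the Legendre polynomials
at `1 / cos 2θ > 1` (`norm_phiS_sq_recurrence`) and is unbounded, and likewise `‖Ψₙ‖²`. As the `eₙ`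
are orthonormal, `T_θ` and its inverse are unbounded, and neither family is a Riesz basis.
-/

noncomputable section

namespace Swanson

/-! ### Unbounded operators described by their graphs -/

section Operators

variable {E : Type*} [NormedAddCommGroup E] [InnerProductSpace ℂ E]

theorem mem_opMul_graph {S T : E →ₗ.[ℂ] E} {x z : E} :
    (x, z) ∈ (opMul S T).graph ↔ ∃ y, (x, y) ∈ T.graph ∧ (y, z) ∈ S.graph := by
  constructor
  · intro h
    obtain ⟨⟨w, hw⟩, hwx, hwz⟩ := (LinearPMap.mem_graph_iff _).1 h
    obtain ⟨⟨⟨w', hw'⟩, hw1, hw2⟩, hw3⟩ := Submodule.mem_inf.1 hw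
    dsimp at hwx hw2
    subst hw2
    subst hwx
    refine ⟨T ⟨w', hw'⟩, T.mem_graph ⟨w', hw'⟩, ?_⟩
    have := LinearPMap.mem_graph S ⟨T ⟨w', hw'⟩, hw1⟩
    rw [← show opMul S T ⟨w', hw⟩ = z from hwz]
    exact this
  · rintro ⟨y, hy, hz⟩
    obtain ⟨⟨w, hw⟩, hwx, hwy⟩ := (LinearPMap.mem_graph_iff _).1 hy
    obtain ⟨⟨v, hv⟩, hvy, hvz⟩ := (LinearPMap.mem_graph_iff _).1 hz
    dsimp at hwx hwy hvy hvz
    subst hwx hwy hvy hvz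
    exact (LinearPMap.mem_graph_iff _).2
      ⟨⟨w, Submodule.mem_inf.2 ⟨⟨⟨w, hw⟩, hv, rfl⟩, hw⟩⟩, rfl, rfl⟩

theorem mem_add_graph {S T : E →ₗ.[ℂ] E} {x z : E} :
    (x, z) ∈ (S + T).graph ↔ ∃ y w, (x, y) ∈ S.graph ∧ (x, w) ∈ T.graph ∧ z = y + w := by
  constructor
  · intro h
    obtain ⟨⟨v, hv⟩, hvx, hvz⟩ := (LinearPMap.mem_graph_iff _).1 h
    dsimp at hvx hvz
    subst hvx
    exact ⟨_, _, S.mem_graph ⟨v, hv.1⟩, T.mem_graph ⟨v, hv.2⟩, hvz.symm⟩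
  · rintro ⟨y, w, hy, hw, rfl⟩
    obtain ⟨⟨v, hv⟩, hvx, hvy⟩ := (LinearPMap.mem_graph_iff _).1 hy
    obtain ⟨⟨v', hv'⟩, hvx', hvy'⟩ := (LinearPMap.mem_graph_iff _).1 hw
    dsimp at hvx hvy hvx' hvy'
    subst hvx hvx' hvy hvy'
    exact (LinearPMap.mem_graph_iff _).2 ⟨⟨v', hv, hv'⟩, rfl, rfl⟩

theorem mem_sub_graph {S T : E →ₗ.[ℂ] E} {x z : E} :
    (x, z) ∈ (S - T).graph ↔ ∃ y w, (x, y) ∈ S.graph ∧ (x, w) ∈ T.graph ∧ z = y - w := by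
  constructor
  · intro h
    obtain ⟨⟨v, hv⟩, hvx, hvz⟩ := (LinearPMap.mem_graph_iff _).1 h
    dsimp at hvx hvz
    subst hvx
    exact ⟨_, _, S.mem_graph ⟨v, hv.1⟩, T.mem_graph ⟨v, hv.2⟩, hvz.symm⟩
  · rintro ⟨y, w, hy, hw, rfl⟩
    obtain ⟨⟨v, hv⟩, hvx, hvy⟩ := (LinearPMap.mem_graph_iff _).1 hy
    obtain ⟨⟨v', hv'⟩, hvx', hvy'⟩ := (LinearPMap.mem_graph_iff _).1 hw
    dsimp at hvx hvy hvx' hvy'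
    subst hvx hvx' hvy hvy'
    exact (LinearPMap.mem_graph_iff _).2 ⟨⟨v', hv, hv'⟩, rfl, rfl⟩

theorem mem_smul_graph {T : E →ₗ.[ℂ] E} {c : ℂ} {x z : E} :
    (x, z) ∈ (c • T).graph ↔ ∃ y, (x, y) ∈ T.graph ∧ z = c • y := by
  constructor
  · intro h
    obtain ⟨v, hvx, hvz⟩ := (LinearPMap.mem_graph_iff _).1 h
    dsimp at hvx hvz
    subst hvx
    exact ⟨_, T.mem_graph v, hvz.symm⟩
  · rintro ⟨y, hy, rfl⟩
    obtain ⟨v, hvx, hvy⟩ := (LinearPMap.mem_graph_iff _).1 hy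
    dsimp at hvx hvy
    subst hvx hvy
    exact (LinearPMap.mem_graph_iff _).2 ⟨v, rfl, rfl⟩

theorem mem_inverse_graph_iff {T : E →ₗ.[ℂ] E} (hT : LinearMap.ker T.toFun = ⊥) {x y : E} :
    (y, x) ∈ T.inverse.graph ↔ (x, y) ∈ T.graph := by
  rw [LinearPMap.inverse_graph hT]
  constructor
  · rintro ⟨⟨a, b⟩, h, hab⟩
    simp only [LinearEquiv.coe_coe, LinearEquiv.prodComm_apply, Prod.swap, Prod.mk.injEq] at hab
    obtain ⟨rfl, rfl⟩ := hab
    exact h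
  · intro h
    exact ⟨(x, y), h, rfl⟩

theorem ker_eq_bot_of_graph {T : E →ₗ.[ℂ] E} (h : ∀ x, (x, (0 : E)) ∈ T.graph → x = 0) :
    LinearMap.ker T.toFun = ⊥ := by
  rw [LinearMap.ker_eq_bot']
  intro x hx
  have := T.mem_graph x
  rw [show T x = 0 from hx] at this
  exact Subtype.ext (h _ this)

theorem mem_adjoint_graph_iff [CompleteSpace E] {T : E →ₗ.[ℂ] E} (hT : Dense (T.domain : Set E))
    {y z : E} :
    (y, z) ∈ T.adjoint.graph ↔ ∀ a b, (a, b) ∈ T.graph → inner ℂ b y = inner ℂ a z := by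
  rw [LinearPMap.adjoint_graph_eq_graph_adjoint hT, Submodule.mem_adjoint_iff]
  simp only [sub_eq_zero]

theorem isFormalAdjoint_iff_graph {S T : E →ₗ.[ℂ] E} : T.IsFormalAdjoint S ↔
    ∀ a b c d, (a, b) ∈ T.graph → (c, d) ∈ S.graph → inner ℂ b c = inner ℂ a d := by
  constructor
  · intro h a b c d hab hcd
    obtain ⟨v, hvx, hvy⟩ := (LinearPMap.mem_graph_iff _).1 hab
    obtain ⟨w, hwx, hwy⟩ := (LinearPMap.mem_graph_iff _).1 hcd
    dsimp at hvx hvy hwx hwy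
    subst hvx hvy hwx hwy
    exact h v w
  · intro h x y
    exact h _ _ _ _ (T.mem_graph x) (S.mem_graph y)

theorem opPow_graph_succ {K : E →ₗ.[ℂ] E} {n : ℕ} {x y z : E} (h : (x, y) ∈ (opPow K n).graph)
    (h' : (x, z) ∈ (opPow K (n + 1)).graph) : (y, z) ∈ K.graph := by
  obtain ⟨w, hw, hwz⟩ := mem_opMul_graph.1 h'
  rwa [LinearPMap.mem_graph_snd_inj _ h hw rfl]

theorem mem_opOne_graph {x y : E} : (x, y) ∈ (opOne : E →ₗ.[ℂ] E).graph ↔ x = y := by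
  rw [LinearPMap.mem_graph_iff]
  constructor
  · rintro ⟨v, rfl, rfl⟩
    rfl
  · rintro rfl
    exact ⟨⟨x, trivial⟩, rfl, rfl⟩

/-- If `u (n + 1) = K u n` for all `n`, then `u n = K ^ n u 0` on the natural domains. -/
theorem mem_opPow_graph_of_chain {K : E →ₗ.[ℂ] E} (u : ℕ → E)
    (hu : ∀ n, (u n, u (n + 1)) ∈ K.graph) (n : ℕ) : (u 0, u n) ∈ (opPow K n).graph := by
  induction n with
  | zero => exact mem_opOne_graph.2 rfl
  | succ n ih => exact mem_opMul_graph.2 ⟨u n, ih, hu n⟩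

/-! ### The exponential of a symmetric operator -/

/-- If `u` and `v` are orbits of a symmetric operator `K`, then `⟪Kⁿ u₀, v₀⟫ = ⟪u₀, Kⁿ v₀⟫`: the
powers are moved across one at a time. -/
theorem inner_chain_eq {K : E →ₗ.[ℂ] E} (hK : K.IsFormalAdjoint K) (u v : ℕ → E)
    (hu : ∀ n, (u n, u (n + 1)) ∈ K.graph) (hv : ∀ n, (v n, v (n + 1)) ∈ K.graph) (n : ℕ) :
    inner ℂ (u n) (v 0) = inner ℂ (u 0) (v n) := by
  have key : ∀ k j, inner ℂ (u k) (v j) = inner ℂ (u 0) (v (j + k)) := by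
    intro k
    induction k with
    | zero => intro j; rfl
    | succ k ih =>
      intro j
      rw [isFormalAdjoint_iff_graph.1 hK _ _ _ _ (hu k) (hv j), ih]
      congr 2
      ring
  simpa using key n 0

/-- The exponential series of a symmetric operator is symmetric, term by term. -/
theorem expGraph_inner {K : E →ₗ.[ℂ] E} (hK : K.IsFormalAdjoint K) {p q : E × E}
    (hp : p ∈ expGraph K) (hq : q ∈ expGraph K) : inner ℂ p.2 q.1 = inner ℂ p.1 q.2 := by
  obtain ⟨u, hu, -, hu2⟩ := hp
  obtain ⟨v, hv, -, hv2⟩ := hq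
  have hu0 : p.1 = u 0 := mem_opOne_graph.1 (hu 0)
  have hv0 : q.1 = v 0 := mem_opOne_graph.1 (hv 0)
  have h1 := hu2.mapL ((innerSL ℂ q.1))
  have h2 := hv2.mapL ((innerSL ℂ p.1))
  have h1' := (Complex.hasSum_conj' ).2 h1
  have : inner ℂ p.2 q.1 = (starRingEnd ℂ) (innerSL ℂ q.1 p.2) := by
    simp [inner_conj_symm]
  rw [this]
  refine h1'.unique ?_
  refine h2.congr_fun fun n => ?_
  have := inner_chain_eq hK u v (fun n => opPow_graph_succ (hu n) (hu (n + 1)))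
    (fun n => opPow_graph_succ (hv n) (hv (n + 1))) n
  simp only [innerSL_apply_apply, inner_smul_right, map_mul, map_inv₀, Complex.conj_natCast,
    inner_conj_symm, hu0, hv0, this]

theorem expGraph_toLinearPMap_graph (K : E →ₗ.[ℂ] E) :
    (expGraph K).toLinearPMap.graph = expGraph K :=
  Submodule.toLinearPMap_graph_eq _ (expGraph_single_valued K)

theorem mem_opExp_graph_of_mem_expGraph {K : E →ₗ.[ℂ] E} {p : E × E} (hp : p ∈ expGraph K) :
    p ∈ (opExp K).graph :=
  LinearPMap.le_graph_of_le (LinearPMap.le_closure _) (by rwa [expGraph_toLinearPMap_graph])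

/-- The cross terms cancel because `⟪T x, x⟫` is real for symmetric `T`. -/
theorem norm_add_I_smul_sq {T : E →ₗ.[ℂ] E} (hs : T.IsFormalAdjoint T) {x y : E}
    (h : (x, y) ∈ T.graph) : ‖y + Complex.I • x‖ ^ 2 = ‖y‖ ^ 2 + ‖x‖ ^ 2 := by
  have h1 := isFormalAdjoint_iff_graph.1 hs _ _ _ _ h h
  have h2 : (inner ℂ y x).im = 0 := by
    rw [← Complex.conj_eq_iff_im, inner_conj_symm, h1]
  rw [norm_add_sq (𝕜 := ℂ), inner_smul_right, norm_smul, Complex.norm_I, one_mul]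
  simp [h2]

variable [CompleteSpace E]

/-- The exponential series of a symmetric operator is closable as soon as it is densely defined,
being symmetric. Hence the graph of `opExp K` is a genuine closure: `LinearPMap.closure` leaves
operators which are not closable unchanged. -/
theorem opExp_graph {K : E →ₗ.[ℂ] E} (hK : K.IsFormalAdjoint K)
    (hd : Dense ((expGraph K).toLinearPMap.domain : Set E)) :
    (opExp K).graph = (expGraph K).topologicalClosure := by
  have hs : (expGraph K).toLinearPMap.IsFormalAdjoint (expGraph K).toLinearPMap := by
    rw [isFormalAdjoint_iff_graph, expGraph_toLinearPMap_graph]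
    exact fun a b c d hab hcd => expGraph_inner hK hab hcd
  have hc : (expGraph K).toLinearPMap.IsClosable :=
    (LinearPMap.adjoint_isClosed hd).isClosable.leIsClosable (hs.le_adjoint hd)
  rw [opExp, ← hc.graph_closure_eq_closure_graph, expGraph_toLinearPMap_graph]

theorem opExp_isClosed {K : E →ₗ.[ℂ] E} (hK : K.IsFormalAdjoint K)
    (hd : Dense ((expGraph K).toLinearPMap.domain : Set E)) : (opExp K).IsClosed := by
  rw [LinearPMap.IsClosed, opExp_graph hK hd]
  exact Submodule.isClosed_topologicalClosure _

theorem opExp_isFormalAdjoint {K : E →ₗ.[ℂ] E} (hK : K.IsFormalAdjoint K)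
    (hd : Dense ((expGraph K).toLinearPMap.domain : Set E)) :
    (opExp K).IsFormalAdjoint (opExp K) := by
  rw [isFormalAdjoint_iff_graph, opExp_graph hK hd]
  have h1 : ∀ p ∈ expGraph K, ∀ q ∈ closure (expGraph K : Set (E × E)),
      inner ℂ p.2 q.1 = inner ℂ p.1 q.2 := by
    intro p hp q hq
    refine closure_minimal (s := (expGraph K : Set (E × E)))
      (t := {q | inner ℂ p.2 q.1 = inner ℂ p.1 q.2}) (fun q hq => expGraph_inner hK hp hq)
      (isClosed_eq (by fun_prop) (by fun_prop)) hq
  intro a b c d hab hcd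
  exact closure_minimal (s := (expGraph K : Set (E × E)))
      (t := {p : E × E | inner ℂ p.2 c = inner ℂ p.1 d}) (fun p hp => h1 p hp (c, d) hcd)
      (isClosed_eq (by fun_prop) (by fun_prop)) hab

/-! ### A criterion for self-adjointness -/

/-- A closed symmetric operator `T` satisfies `‖T x‖² + ‖x‖² = ‖(T + i) x‖²`, so that `T + i` has
closed range; if the range is also dense then `T + i` is onto. -/
theorem exists_mem_graph_add_I_smul_eq {T : E →ₗ.[ℂ] E} (hT : T.IsClosed)
    (hs : T.IsFormalAdjoint T)
    (hd : ∀ g : E, (∀ x y, (x, y) ∈ T.graph → inner ℂ (y + Complex.I • x) g = 0) → g = 0) (z : E) :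
    ∃ x y, (x, y) ∈ T.graph ∧ y + Complex.I • x = z := by
  let f : T.graph →L[ℂ] E :=
    ((ContinuousLinearMap.snd ℂ E E) + Complex.I • (ContinuousLinearMap.fst ℂ E E)).comp
      T.graph.subtypeL
  have hf : ∀ p : T.graph, f p = p.1.2 + Complex.I • p.1.1 := fun p => rfl
  have hbound : ∀ p : T.graph, ‖p‖ ≤ (1 : NNReal) * ‖f p‖ := by
    intro p
    have h1 := norm_add_I_smul_sq hs (x := p.1.1) (y := p.1.2) p.2
    rw [hf, NNReal.coe_one, one_mul]
    change ‖p.1‖ ≤ _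
    rw [Prod.norm_def]
    refine max_le (abs_le_of_sq_le_sq' ?_ (norm_nonneg _)).2
      (abs_le_of_sq_le_sq' ?_ (norm_nonneg _)).2
    · rw [h1]; linarith [sq_nonneg ‖p.1.2‖]
    · rw [h1]; linarith [sq_nonneg ‖p.1.1‖]
  have hanti := AddMonoidHomClass.antilipschitz_of_bound f hbound
  have : CompleteSpace T.graph := (hT : IsClosed (T.graph : Set (E × E))).completeSpace_coe
  have hcl : IsClosed (Set.range f) := hanti.isClosed_range f.uniformContinuous
  have hcl' : (LinearMap.range f.toLinearMap).topologicalClosure = LinearMap.range f.toLinearMap :=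
    IsClosed.submodule_topologicalClosure_eq (by rw [LinearMap.coe_range]; exact hcl)
  have htop : LinearMap.range f.toLinearMap = ⊤ := by
    rw [← hcl', Submodule.topologicalClosure_eq_top_iff, Submodule.eq_bot_iff]
    intro g hg
    refine hd g fun x y hxy => ?_
    exact (Submodule.mem_orthogonal _ _).1 hg _ ⟨⟨(x, y), hxy⟩, rfl⟩
  obtain ⟨p, hp⟩ : z ∈ LinearMap.range f.toLinearMap := htop ▸ trivial
  exact ⟨p.1.1, p.1.2, p.2, hp⟩

/-- If `T` is closed and symmetric and `T ± i` have dense range on the vectors `u n`, then the `u n`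
span a core of `T`, in the strong sense that the weak equations `⟪T (u n), g⟫ = ⟪u n, h⟫` force
`T g = h`. -/
theorem mem_graph_of_inner_eq {ι : Type*} {T : E →ₗ.[ℂ] E} (hT : T.IsClosed)
    (hs : T.IsFormalAdjoint T) {u v : ι → E} (huv : ∀ i, (u i, v i) ∈ T.graph)
    (hd : ∀ σ : ℂ, σ = Complex.I ∨ σ = -Complex.I →
      ∀ g : E, (∀ i, inner ℂ (v i + σ • u i) g = 0) → g = 0)
    {g h : E} (hgh : ∀ i, inner ℂ (v i) g = inner ℂ (u i) h) : (g, h) ∈ T.graph := by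
  obtain ⟨x, y, hxy, hz⟩ := exists_mem_graph_add_I_smul_eq hT hs
    (fun g hg => hd _ (Or.inl rfl) g fun i => hg _ _ (huv i)) (h + Complex.I • g)
  have h0 : g - x = 0 := by
    refine hd _ (Or.inr rfl) _ fun i => ?_
    have h1 := isFormalAdjoint_iff_graph.1 hs _ _ _ _ (huv i) hxy
    have h2 := congrArg (inner ℂ (u i)) hz
    simp only [inner_add_right, inner_smul_right] at h2
    simp only [inner_add_left, inner_smul_left, inner_sub_right, hgh, h1, map_neg, Complex.conj_I,
      neg_neg]
    linear_combination -h2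
  have hgx : g = x := sub_eq_zero.1 h0
  subst hgx
  have : y = h := by simpa using hz
  rwa [← this]

theorem isSelfAdjoint_of_core {ι : Type*} {T : E →ₗ.[ℂ] E} (hT : T.IsClosed)
    (hdense : Dense (T.domain : Set E))
    (hs : T.IsFormalAdjoint T) {u v : ι → E} (huv : ∀ i, (u i, v i) ∈ T.graph)
    (hd : ∀ σ : ℂ, σ = Complex.I ∨ σ = -Complex.I →
      ∀ g : E, (∀ i, inner ℂ (v i + σ • u i) g = 0) → g = 0) : IsSelfAdjoint T := by
  rw [LinearPMap.isSelfAdjoint_def]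
  refine le_antisymm ?_ (hs.le_adjoint hdense)
  rw [← LinearPMap.le_graph_iff]
  rintro ⟨g, h⟩ hgh
  exact mem_graph_of_inner_eq hT hs huv hd
    fun i => (mem_adjoint_graph_iff hdense).1 hgh _ _ (huv i)

end Operators

end Swanson

namespace Swanson

/-! ### Operators on Schwartz functions -/

/-- Multiplication by the coordinate, on `𝓢(ℝ)`. -/
def mulX : 𝓢(ℝ, ℂ) →ₗ[ℂ] 𝓢(ℝ, ℂ) :=
  (SchwartzMap.smulLeftCLM ℂ (fun x : ℝ => (x : ℂ))).toLinearMap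

/-- Differentiation, on `𝓢(ℝ)`. -/
def derivS : 𝓢(ℝ, ℂ) →ₗ[ℂ] 𝓢(ℝ, ℂ) := (SchwartzMap.derivCLM ℂ ℂ).toLinearMap

theorem mulX_apply (f : 𝓢(ℝ, ℂ)) (x : ℝ) : mulX f x = x * f x := by
  have h : (fun x : ℝ => (x : ℂ)).HasTemperateGrowth := by fun_prop
  exact SchwartzMap.smulLeftCLM_apply_apply h f x

theorem derivS_apply (f : 𝓢(ℝ, ℂ)) (x : ℝ) : derivS f x = deriv f x :=
  SchwartzMap.derivCLM_apply ℂ f x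

/-- The canonical commutation relation `[d/dx, x] = 1`. -/
theorem derivS_mulX (f : 𝓢(ℝ, ℂ)) : derivS (mulX f) = f + mulX (derivS f) := by
  ext x
  have h : HasDerivAt (mulX f) (1 * f x + x * deriv f x) x := by
    have h1 : (mulX f : ℝ → ℂ) = fun x : ℝ => (x : ℂ) * f x := funext (mulX_apply f)
    rw [h1]
    exact (Complex.ofRealCLM.hasDerivAt (x := x)).mul f.differentiableAt.hasDerivAt
  rw [derivS_apply, h.deriv, add_apply, mulX_apply, derivS_apply, one_mul]

theorem inner_toL2 (f g : 𝓢(ℝ, ℂ)) :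
    inner ℂ (toL2 f) (toL2 g) = ∫ x, (starRingEnd ℂ) (f x) * g x := by
  refine (SchwartzMap.inner_toL2_toL2_eq f g).trans ?_
  simp only [RCLike.inner_apply, mul_comm]

theorem inner_mulX (f g : 𝓢(ℝ, ℂ)) :
    inner ℂ (toL2 (mulX f)) (toL2 g) = inner ℂ (toL2 f) (toL2 (mulX g)) := by
  rw [inner_toL2, inner_toL2]
  congr 1
  funext x
  rw [mulX_apply, mulX_apply, map_mul, Complex.conj_ofReal]
  ring

theorem inner_derivS (f g : 𝓢(ℝ, ℂ)) :
    inner ℂ (toL2 (derivS f)) (toL2 g) = -inner ℂ (toL2 f) (toL2 (derivS g)) := by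
  rw [inner_toL2, inner_toL2]
  have := SchwartzMap.integral_bilinear_deriv_right_eq_neg_left f g
    ((ContinuousLinearMap.mul ℝ ℂ).comp (Complex.conjCLE : ℂ →L[ℝ] ℂ))
  simp only [derivS_apply]
  simp only [ContinuousLinearMap.comp_apply, ContinuousLinearMap.mul_apply'] at this
  rw [eq_neg_iff_add_eq_zero, add_comm, ← eq_neg_iff_add_eq_zero]
  exact this

theorem schwartzSpace_dense : Dense (schwartzSpace : Set L2) := by
  have h := SchwartzMap.denseRange_toLpCLM (E := ℝ) (F := ℂ) (p := 2)
    (μ := MeasureTheory.volume) (by simp)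
  exact h

/-- Unbounded operators with domain `𝓢(ℝ)` are thereby computed on Schwartz functions. -/
theorem mem_ofSchwartz_graph {L : 𝓢(ℝ, ℂ) →ₗ[ℂ] 𝓢(ℝ, ℂ)} {f g : L2} :
    (f, g) ∈ (ofSchwartz L).graph ↔ ∃ s, toL2 s = f ∧ toL2 (L s) = g := by
  have key : ∀ s (h : toL2 s ∈ (ofSchwartz L).domain), ofSchwartz L ⟨toL2 s, h⟩ = toL2 (L s) := by
    intro s h
    change toL2 (L ((LinearEquiv.ofInjective toL2 toL2_injective).symm ⟨toL2 s, _⟩)) = _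
    congr 2
    exact (LinearEquiv.symm_apply_eq _).2 (Subtype.ext rfl)
  rw [LinearPMap.mem_graph_iff]
  constructor
  · rintro ⟨⟨v, hv⟩, h1, h2⟩
    dsimp at h1 h2
    subst h1
    obtain ⟨s, rfl⟩ := hv
    exact ⟨s, rfl, (key s _).symm.trans h2⟩
  · rintro ⟨s, rfl, rfl⟩
    exact ⟨⟨toL2 s, ⟨s, rfl⟩⟩, rfl, key s _⟩

theorem toL2_mem_ofSchwartz_graph (L : 𝓢(ℝ, ℂ) →ₗ[ℂ] 𝓢(ℝ, ℂ)) (s : 𝓢(ℝ, ℂ)) :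
    (toL2 s, toL2 (L s)) ∈ (ofSchwartz L).graph := mem_ofSchwartz_graph.2 ⟨s, rfl, rfl⟩

theorem ofSchwartz_le_iff {L : 𝓢(ℝ, ℂ) →ₗ[ℂ] 𝓢(ℝ, ℂ)} {T : L2 →ₗ.[ℂ] L2} :
    ofSchwartz L ≤ T ↔ ∀ s, (toL2 s, toL2 (L s)) ∈ T.graph := by
  rw [← LinearPMap.le_graph_iff]
  constructor
  · exact fun h s => h (toL2_mem_ofSchwartz_graph L s)
  · rintro h ⟨f, g⟩ hfg
    obtain ⟨s, rfl, rfl⟩ := mem_ofSchwartz_graph.1 hfg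
    exact h s

theorem smul_ofSchwartz (c : ℂ) (L : 𝓢(ℝ, ℂ) →ₗ[ℂ] 𝓢(ℝ, ℂ)) :
    c • ofSchwartz L = ofSchwartz (c • L) := by
  refine LinearPMap.eq_of_eq_graph (Submodule.ext ?_)
  rintro ⟨f, g⟩
  simp only [mem_smul_graph, mem_ofSchwartz_graph]
  constructor
  · rintro ⟨y, ⟨s, rfl, rfl⟩, rfl⟩
    exact ⟨s, rfl, by simp⟩
  · rintro ⟨s, rfl, rfl⟩
    exact ⟨_, ⟨s, rfl, rfl⟩, by simp⟩

/-- Adding an operator defined on more than `𝓢(ℝ)` does not change the domain `𝓢(ℝ)`. -/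
theorem ofSchwartz_add_of_le {L M : 𝓢(ℝ, ℂ) →ₗ[ℂ] 𝓢(ℝ, ℂ)} {T : L2 →ₗ.[ℂ] L2}
    (h : ofSchwartz M ≤ T) : ofSchwartz L + T = ofSchwartz (L + M) := by
  refine LinearPMap.eq_of_eq_graph (Submodule.ext ?_)
  rintro ⟨f, g⟩
  simp only [mem_add_graph, mem_ofSchwartz_graph]
  constructor
  · rintro ⟨y, w, ⟨s, rfl, rfl⟩, hw, rfl⟩
    refine ⟨s, rfl, ?_⟩
    rw [T.mem_graph_snd_inj hw (ofSchwartz_le_iff.1 h s) rfl]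
    simp
  · rintro ⟨s, rfl, rfl⟩
    exact ⟨_, _, ⟨s, rfl, rfl⟩, ofSchwartz_le_iff.1 h s, by simp⟩

theorem ofSchwartz_sub_of_le {L M : 𝓢(ℝ, ℂ) →ₗ[ℂ] 𝓢(ℝ, ℂ)} {T : L2 →ₗ.[ℂ] L2}
    (h : ofSchwartz M ≤ T) : ofSchwartz L - T = ofSchwartz (L - M) := by
  refine LinearPMap.eq_of_eq_graph (Submodule.ext ?_)
  rintro ⟨f, g⟩
  simp only [mem_sub_graph, mem_ofSchwartz_graph]
  constructor
  · rintro ⟨y, w, ⟨s, rfl, rfl⟩, hw, rfl⟩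
    refine ⟨s, rfl, ?_⟩
    rw [T.mem_graph_snd_inj hw (ofSchwartz_le_iff.1 h s) rfl]
    simp
  · rintro ⟨s, rfl, rfl⟩
    exact ⟨_, _, ⟨s, rfl, rfl⟩, ofSchwartz_le_iff.1 h s, by simp⟩

theorem smul_ofSchwartz_le {c : ℂ} {L : 𝓢(ℝ, ℂ) →ₗ[ℂ] 𝓢(ℝ, ℂ)} {T : L2 →ₗ.[ℂ] L2}
    (h : ofSchwartz L ≤ T) : ofSchwartz (c • L) ≤ c • T := by
  rw [ofSchwartz_le_iff] at h ⊢
  exact fun s => mem_smul_graph.2 ⟨_, h s, by simp⟩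

theorem ofSchwartz_comp_le_opMul {L M : 𝓢(ℝ, ℂ) →ₗ[ℂ] 𝓢(ℝ, ℂ)} {S T : L2 →ₗ.[ℂ] L2}
    (hS : ofSchwartz L ≤ S) (hT : ofSchwartz M ≤ T) : ofSchwartz (L ∘ₗ M) ≤ opMul S T := by
  rw [ofSchwartz_le_iff] at hS hT ⊢
  exact fun s => mem_opMul_graph.2 ⟨_, hT s, hS (M s)⟩

theorem opMul_ofSchwartz (L M : 𝓢(ℝ, ℂ) →ₗ[ℂ] 𝓢(ℝ, ℂ)) :
    opMul (ofSchwartz L) (ofSchwartz M) = ofSchwartz (L ∘ₗ M) := by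
  refine le_antisymm ?_ (ofSchwartz_comp_le_opMul le_rfl le_rfl)
  rw [← LinearPMap.le_graph_iff]
  rintro ⟨f, g⟩ h
  obtain ⟨y, hy, hg⟩ := mem_opMul_graph.1 h
  obtain ⟨s, rfl, rfl⟩ := mem_ofSchwartz_graph.1 hy
  obtain ⟨t, ht, rfl⟩ := mem_ofSchwartz_graph.1 hg
  rw [toL2_injective ht]
  exact toL2_mem_ofSchwartz_graph _ s

theorem ofSchwartz_domain_dense (L : 𝓢(ℝ, ℂ) →ₗ[ℂ] 𝓢(ℝ, ℂ)) :
    Dense ((ofSchwartz L).domain : Set L2) := schwartzSpace_dense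

theorem ofSchwartz_isFormalAdjoint {L M : 𝓢(ℝ, ℂ) →ₗ[ℂ] 𝓢(ℝ, ℂ)}
    (h : ∀ f g, inner ℂ (toL2 (L f)) (toL2 g) = inner ℂ (toL2 f) (toL2 (M g))) :
    (ofSchwartz L).IsFormalAdjoint (ofSchwartz M) := by
  rw [isFormalAdjoint_iff_graph]
  intro a b c d hab hcd
  obtain ⟨s, rfl, rfl⟩ := mem_ofSchwartz_graph.1 hab
  obtain ⟨t, rfl, rfl⟩ := mem_ofSchwartz_graph.1 hcd
  exact h s t

theorem ofSchwartz_le_adjoint {L M : 𝓢(ℝ, ℂ) →ₗ[ℂ] 𝓢(ℝ, ℂ)}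
    (h : ∀ f g, inner ℂ (toL2 (L f)) (toL2 g) = inner ℂ (toL2 f) (toL2 (M g))) :
    ofSchwartz M ≤ (ofSchwartz L).adjoint :=
  (ofSchwartz_isFormalAdjoint h).le_adjoint (ofSchwartz_domain_dense L)

theorem ofSchwartz_id_eq_toPMap :
    ofSchwartz LinearMap.id = (LinearMap.id : L2 →ₗ[ℂ] L2).toPMap schwartzSpace := by
  refine LinearPMap.eq_of_eq_graph (Submodule.ext ?_)
  rintro ⟨f, g⟩
  rw [mem_ofSchwartz_graph, LinearPMap.mem_graph_iff]
  constructor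
  · rintro ⟨s, rfl, rfl⟩
    exact ⟨⟨toL2 s, ⟨s, rfl⟩⟩, rfl, rfl⟩
  · rintro ⟨⟨v, s, hs⟩, h1, h2⟩
    exact ⟨s, hs.trans h1, hs.trans h2⟩

theorem ofSchwartz_id_le_opOne : ofSchwartz LinearMap.id ≤ (opOne : L2 →ₗ.[ℂ] L2) := by
  rw [ofSchwartz_le_iff]
  exact fun s => mem_opOne_graph.2 rfl

/-! ### Ladder operators -/

/-- The first order operator `(u x + v d/dx) / √2` on `𝓢(ℝ)`. -/
def ladder (u v : ℂ) : 𝓢(ℝ, ℂ) →ₗ[ℂ] 𝓢(ℝ, ℂ) := (Real.sqrt 2 : ℂ)⁻¹ • (u • mulX + v • derivS)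

theorem ladder_apply (u v : ℂ) (f : 𝓢(ℝ, ℂ)) :
    ladder u v f = (Real.sqrt 2 : ℂ)⁻¹ • (u • mulX f + v • derivS f) := rfl

theorem inv_sqrt_two_mul_self : (Real.sqrt 2 : ℂ)⁻¹ * (Real.sqrt 2 : ℂ)⁻¹ = 1 / 2 := by
  rw [← mul_inv, ← Complex.ofReal_mul, Real.mul_self_sqrt (by norm_num)]
  norm_num

theorem smul_ladder (c u v : ℂ) : c • ladder u v = ladder (c * u) (c * v) := by
  ext1 f
  simp only [LinearMap.smul_apply, ladder_apply]
  module

theorem ladder_add (u v u' v' : ℂ) :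
    ladder u v + ladder u' v' = ladder (u + u') (v + v') := by
  ext1 f
  simp only [LinearMap.add_apply, ladder_apply]
  module

theorem ladder_ladder (u v u' v' : ℂ) (f : 𝓢(ℝ, ℂ)) :
    ladder u v (ladder u' v' f) = (1 / 2 : ℂ) • ((u * u') • mulX (mulX f)
      + (u * v' + v * u') • mulX (derivS f) + (v * u') • f + (v * v') • derivS (derivS f)) := by
  simp only [ladder_apply, map_smul, map_add, derivS_mulX, ← inv_sqrt_two_mul_self]
  module

theorem inner_ladder (u v : ℂ) (f g : 𝓢(ℝ, ℂ)) :
    inner ℂ (toL2 (ladder u v f)) (toL2 g) =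
      inner ℂ (toL2 f) (toL2 (ladder ((starRingEnd ℂ) u) (-(starRingEnd ℂ) v) g)) := by
  simp only [ladder_apply, map_smul, map_add, inner_smul_left, inner_add_left, inner_smul_right,
    inner_add_right, inner_mulX, inner_derivS, map_inv₀, Complex.conj_ofReal]
  ring

theorem opX_eq : opX = ofSchwartz mulX := rfl

theorem opP_eq : opP = ofSchwartz (-Complex.I • derivS) := rfl

theorem opa_eq : opa = ofSchwartz (ladder 1 1) := by
  rw [opa, opX_eq, opP_eq, smul_ofSchwartz, ofSchwartz_add_of_le le_rfl, smul_ofSchwartz]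
  congr 1
  ext1 f
  simp only [LinearMap.smul_apply, LinearMap.add_apply, ladder_apply, smul_smul]
  simp

theorem ofSchwartz_le_opadag : ofSchwartz (ladder 1 (-1)) ≤ opadag := by
  rw [opadag, opa_eq]
  refine ofSchwartz_le_adjoint fun f g => ?_
  rw [inner_ladder, map_one]

/-- `A_θ` as an operator on `𝓢(ℝ)`. -/
def lowerS (θ : ℝ) : 𝓢(ℝ, ℂ) →ₗ[ℂ] 𝓢(ℝ, ℂ) :=
  ladder (Complex.exp (Complex.I * θ)) (Complex.exp (-(Complex.I * θ)))

/-- `B_θ` as an operator on `𝓢(ℝ)`. -/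
def raiseS (θ : ℝ) : 𝓢(ℝ, ℂ) →ₗ[ℂ] 𝓢(ℝ, ℂ) :=
  ladder (Complex.exp (Complex.I * θ)) (-Complex.exp (-(Complex.I * θ)))

theorem exp_I_mul (θ : ℝ) :
    Complex.exp (Complex.I * θ) = Real.cos θ + Complex.I * Real.sin θ := by
  rw [mul_comm, Complex.exp_mul_I, Complex.ofReal_cos, Complex.ofReal_sin, mul_comm Complex.I]

theorem exp_neg_I_mul (θ : ℝ) :
    Complex.exp (-(Complex.I * θ)) = Real.cos θ - Complex.I * Real.sin θ := by
  have h := exp_I_mul (-θ)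
  rw [Complex.ofReal_neg, mul_neg] at h
  rw [h, Real.cos_neg, Real.sin_neg, Complex.ofReal_neg]
  ring

/-- `a†` extends its Schwartz version, and its domain is cut down to `𝓢(ℝ)` by the summand `a`. -/
theorem opA_eq (θ : ℝ) : opA θ = ofSchwartz (lowerS θ) := by
  rw [opA, opa_eq, smul_ofSchwartz, ofSchwartz_add_of_le (smul_ofSchwartz_le ofSchwartz_le_opadag),
    smul_ladder, smul_ladder, ladder_add, lowerS, exp_I_mul, exp_neg_I_mul]
  congr 2 <;> ring

theorem opB_eq (θ : ℝ) : opB θ = ofSchwartz (raiseS θ) := by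
  rw [opB, add_comm, opa_eq, smul_ofSchwartz,
    ofSchwartz_add_of_le (smul_ofSchwartz_le ofSchwartz_le_opadag),
    smul_ladder, smul_ladder, ladder_add, raiseS, exp_I_mul, exp_neg_I_mul]
  congr 2 <;> ring

theorem conj_exp_I_mul (θ : ℝ) :
    (starRingEnd ℂ) (Complex.exp (Complex.I * θ)) = Complex.exp (-(Complex.I * θ)) := by
  rw [← Complex.exp_conj, map_mul, Complex.conj_I, Complex.conj_ofReal, neg_mul]

theorem conj_exp_neg_I_mul (θ : ℝ) :
    (starRingEnd ℂ) (Complex.exp (-(Complex.I * θ))) = Complex.exp (Complex.I * θ) := by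
  rw [← conj_exp_I_mul, Complex.conj_conj]

theorem exp_I_mul_mul_exp_neg (θ : ℝ) :
    Complex.exp (Complex.I * θ) * Complex.exp (-(Complex.I * θ)) = 1 := by
  rw [← Complex.exp_add, add_neg_cancel, Complex.exp_zero]

theorem inner_lowerS (θ : ℝ) (f g : 𝓢(ℝ, ℂ)) :
    inner ℂ (toL2 (lowerS θ f)) (toL2 g) = inner ℂ (toL2 f) (toL2 (raiseS (-θ) g)) := by
  rw [lowerS, inner_ladder, raiseS, conj_exp_I_mul, conj_exp_neg_I_mul]
  simp

theorem inner_raiseS (θ : ℝ) (f g : 𝓢(ℝ, ℂ)) :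
    inner ℂ (toL2 (raiseS θ f)) (toL2 g) = inner ℂ (toL2 f) (toL2 (lowerS (-θ) g)) := by
  rw [raiseS, inner_ladder, lowerS, map_neg, conj_exp_I_mul, conj_exp_neg_I_mul]
  simp

theorem ofSchwartz_le_opA_adjoint (θ : ℝ) : ofSchwartz (raiseS (-θ)) ≤ (opA θ).adjoint := by
  rw [opA_eq]
  exact ofSchwartz_le_adjoint (inner_lowerS θ)

theorem ofSchwartz_le_opB_adjoint (θ : ℝ) : ofSchwartz (lowerS (-θ)) ≤ (opB θ).adjoint := by
  rw [opB_eq]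
  exact ofSchwartz_le_adjoint (inner_raiseS θ)

theorem lowerS_raiseS_sub (θ : ℝ) :
    lowerS θ ∘ₗ raiseS θ - raiseS θ ∘ₗ lowerS θ = LinearMap.id := by
  ext1 f
  simp only [LinearMap.sub_apply, LinearMap.comp_apply, lowerS, raiseS, ladder_ladder,
    LinearMap.id_apply]
  have h := exp_I_mul_mul_exp_neg θ
  set a := Complex.exp (Complex.I * θ)
  set b := Complex.exp (-(Complex.I * θ))
  match_scalars
  · ring
  · ring
  · linear_combination h
  · ring

theorem opA_opB_commutator (θ : ℝ) :
    opMul (opA θ) (opB θ) - opMul (opB θ) (opA θ) =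
      (LinearMap.id : L2 →ₗ[ℂ] L2).toPMap schwartzSpace := by
  rw [opA_eq, opB_eq, opMul_ofSchwartz, opMul_ofSchwartz, ofSchwartz_sub_of_le le_rfl,
    lowerS_raiseS_sub, ofSchwartz_id_eq_toPMap]

/-- The Swanson hamiltonian as an operator on `𝓢(ℝ)`, in factorized form. -/
def hamS (θ : ℝ) : 𝓢(ℝ, ℂ) →ₗ[ℂ] 𝓢(ℝ, ℂ) :=
  ((Real.cos (2 * θ) : ℂ)⁻¹) • (raiseS θ ∘ₗ lowerS θ + (1 / 2 : ℂ) • LinearMap.id)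

theorem cos_two_mul_smul_opMul_add (θ : ℝ) :
    ((Real.cos (2 * θ) : ℂ)⁻¹) • (opMul (opB θ) (opA θ) + (1 / 2 : ℂ) • opOne) =
      ofSchwartz (hamS θ) := by
  rw [opA_eq, opB_eq, opMul_ofSchwartz,
    ofSchwartz_add_of_le (smul_ofSchwartz_le ofSchwartz_id_le_opOne), smul_ofSchwartz, hamS]

theorem opH_eq {θ : ℝ} (hθ : Real.cos (2 * θ) ≠ 0) : opH θ = ofSchwartz (hamS θ) := by
  rw [opH, opX_eq, opP_eq]
  simp only [opMul_ofSchwartz, smul_ofSchwartz, ofSchwartz_add_of_le le_rfl,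
    ofSchwartz_sub_of_le le_rfl]
  congr 1
  ext1 f
  simp only [hamS, lowerS, raiseS, LinearMap.sub_apply, LinearMap.smul_apply, LinearMap.add_apply,
    LinearMap.comp_apply, ladder_ladder, LinearMap.id_apply, map_smul, Real.tan_eq_sin_div_cos,
    Complex.ofReal_div]
  have h := exp_I_mul_mul_exp_neg θ
  have hc : (Real.cos (2 * θ) : ℂ) ≠ 0 := Complex.ofReal_ne_zero.2 hθ
  have h1 : Complex.exp (Complex.I * θ) * Complex.exp (Complex.I * θ) =
      Real.cos (2 * θ) + Complex.I * Real.sin (2 * θ) := by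
    rw [← exp_I_mul, ← Complex.exp_add]
    congr 1
    push_cast
    ring
  have h2 : Complex.exp (-(Complex.I * θ)) * Complex.exp (-(Complex.I * θ)) =
      Real.cos (2 * θ) - Complex.I * Real.sin (2 * θ) := by
    rw [← exp_neg_I_mul, ← Complex.exp_add]
    congr 1
    push_cast
    ring
  set a := Complex.exp (Complex.I * θ)
  set b := Complex.exp (-(Complex.I * θ))
  set c := (Real.cos (2 * θ) : ℂ)
  set s := (Real.sin (2 * θ) : ℂ)
  have hI := Complex.I_mul_I
  match_scalars
  · field_simp
    linear_combination (c - Complex.I * s) * hI + h2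
  · field_simp
    linear_combination - h1
  · ring
  · field_simp
    linear_combination h

/-! ### The generator of dilations -/

/-- The antisymmetric generator `x d/dx + 1/2` of dilations, on `𝓢(ℝ)`. -/
def dilS : 𝓢(ℝ, ℂ) →ₗ[ℂ] 𝓢(ℝ, ℂ) := mulX ∘ₗ derivS + (1 / 2 : ℂ) • LinearMap.id

theorem inner_dilS (f g : 𝓢(ℝ, ℂ)) :
    inner ℂ (toL2 (dilS f)) (toL2 g) = -inner ℂ (toL2 f) (toL2 (dilS g)) := by
  simp only [dilS, LinearMap.add_apply, LinearMap.smul_apply, LinearMap.comp_apply,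
    LinearMap.id_apply, map_add, map_smul, inner_add_left, inner_add_right, inner_smul_left,
    inner_smul_right, inner_mulX, inner_derivS, derivS_mulX]
  simp only [one_div, map_inv₀, Complex.conj_ofNat]
  ring

/-- The exponent of `T_θ` is `iθ (x d/dx + 1/2)`: the second order terms of `a²` and `a†²` cancel.
-/
theorem opT_generator_eq (θ : ℝ) :
    (Complex.I * (θ : ℂ) / 2) • (opMul opa opa - opMul opadag opadag) =
      ofSchwartz ((Complex.I * θ) • dilS) := by
  rw [opa_eq, opMul_ofSchwartz, ofSchwartz_sub_of_le
    (ofSchwartz_comp_le_opMul ofSchwartz_le_opadag ofSchwartz_le_opadag), smul_ofSchwartz]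
  congr 1
  ext1 f
  simp only [LinearMap.sub_apply, LinearMap.smul_apply, LinearMap.add_apply,
    LinearMap.comp_apply, ladder_ladder, LinearMap.id_apply, dilS]
  module

theorem opT_generator_isFormalAdjoint (θ : ℝ) :
    (ofSchwartz ((Complex.I * θ) • dilS)).IsFormalAdjoint
      (ofSchwartz ((Complex.I * θ) • dilS)) := by
  refine ofSchwartz_isFormalAdjoint fun f g => ?_
  simp only [LinearMap.smul_apply, map_smul, inner_smul_left, inner_smul_right, inner_dilS, map_mul,
    Complex.conj_I, Complex.conj_ofReal]
  ring

end Swanson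

namespace Swanson

/-! ### Polynomials times complex Gaussians -/

open Polynomial in
/-- A polynomial grows more slowly than any Gaussian `exp (b x²)`. -/
theorem exists_norm_eval_le_exp (P : ℂ[X]) {b : ℝ} (hb : 0 < b) :
    ∃ C : ℝ, 0 ≤ C ∧ ∀ x : ℝ, ‖P.eval (x : ℂ)‖ ≤ C * Real.exp (b * x ^ 2) := by
  induction P using Polynomial.induction_on' with
  | add P Q hP hQ =>
    obtain ⟨C, hC, h⟩ := hP
    obtain ⟨D, hD, h'⟩ := hQ
    refine ⟨C + D, by positivity, fun x => ?_⟩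
    rw [Polynomial.eval_add, add_mul]
    exact (norm_add_le _ _).trans (add_le_add (h x) (h' x))
  | monomial n a =>
    refine ⟨‖a‖ * (n.factorial * Real.exp (1 / (4 * b))), by positivity, fun x => ?_⟩
    rw [Polynomial.eval_monomial, norm_mul, norm_pow, Complex.norm_real, Real.norm_eq_abs,
      mul_assoc]
    gcongr
    have h1 := Real.pow_div_factorial_le_exp _ (abs_nonneg x) n
    rw [div_le_iff₀ (by positivity)] at h1
    refine h1.trans ?_
    rw [mul_comm, mul_assoc, ← Real.exp_add]
    gcongr
    have h2 : 0 ≤ b * (|x| - 1 / (2 * b)) ^ 2 := by positivity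
    have h3 : b * (|x| - 1 / (2 * b)) ^ 2 = b * x ^ 2 - |x| + 1 / (4 * b) := by
      rw [← sq_abs x]
      field_simp
      ring
    linarith

/-- The Gaussian `exp (-w x² / 2)`. -/
def gauss (w : ℂ) (x : ℝ) : ℂ := Complex.exp (-(w * (x : ℂ) ^ 2) / 2)

theorem norm_gauss (w : ℂ) (x : ℝ) : ‖gauss w x‖ = Real.exp (-(w.re * x ^ 2) / 2) := by
  have h : -(w * (x : ℂ) ^ 2) / 2 = w * ((-(x ^ 2) / 2 : ℝ) : ℂ) := by push_cast; ring
  rw [gauss, Complex.norm_exp, h, Complex.re_mul_ofReal]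
  congr 1
  ring

theorem hasDerivAt_gauss (w : ℂ) (x : ℝ) : HasDerivAt (gauss w) (-(w * x) * gauss w x) x := by
  have h1 : HasDerivAt (fun x : ℝ => (x : ℂ)) 1 x := Complex.ofRealCLM.hasDerivAt (x := x)
  have h2 := (((h1.pow 2).const_mul w).neg.div_const 2).cexp
  refine h2.congr_deriv ?_
  change Complex.exp (-(w * (x : ℂ) ^ 2) / 2) * (-(w * (((2 : ℕ) : ℂ) * (x : ℂ) ^ 1 * 1)) / 2) = _
  rw [gauss]
  push_cast
  ring

theorem hasDerivAt_eval_ofReal (P : Polynomial ℂ) (x : ℝ) :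
    HasDerivAt (fun x : ℝ => P.eval (x : ℂ)) (P.derivative.eval (x : ℂ)) x :=
  (P.hasDerivAt (x : ℂ)).comp_ofReal

/-- The polynomial `Q` with `(P e^{-w x² / 2})' = Q e^{-w x² / 2}`. -/
def polyDeriv (w : ℂ) (P : Polynomial ℂ) : Polynomial ℂ :=
  Polynomial.derivative P - Polynomial.C w * (Polynomial.X * P)

theorem hasDerivAt_eval_mul_gauss (w : ℂ) (P : Polynomial ℂ) (x : ℝ) :
    HasDerivAt (fun x : ℝ => P.eval (x : ℂ) * gauss w x)
      ((polyDeriv w P).eval (x : ℂ) * gauss w x) x := by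
  refine ((hasDerivAt_eval_ofReal P x).mul (hasDerivAt_gauss w x)).congr_deriv ?_
  simp only [polyDeriv, Polynomial.eval_sub, Polynomial.eval_mul, Polynomial.eval_C,
    Polynomial.eval_X]
  ring

theorem iteratedDeriv_eval_mul_gauss (w : ℂ) (P : Polynomial ℂ) (n : ℕ) :
    iteratedDeriv n (fun x : ℝ => P.eval (x : ℂ) * gauss w x) =
      fun x : ℝ => ((polyDeriv w)^[n] P).eval (x : ℂ) * gauss w x := by
  induction n generalizing P with
  | zero => rfl
  | succ n ih =>
    rw [iteratedDeriv_succ', show deriv (fun x : ℝ => P.eval (x : ℂ) * gauss w x) = _ from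
      funext fun x => (hasDerivAt_eval_mul_gauss w P x).deriv, ih, Function.iterate_succ_apply]

theorem contDiff_eval_mul_gauss (w : ℂ) (P : Polynomial ℂ) (n : ℕ∞) :
    ContDiff ℝ n (fun x : ℝ => P.eval (x : ℂ) * gauss w x) := by
  refine contDiff_of_differentiable_iteratedDeriv fun m _ => ?_
  rw [iteratedDeriv_eval_mul_gauss]
  exact fun x => (hasDerivAt_eval_mul_gauss w _ x).differentiableAt

theorem exists_norm_eval_mul_gauss_le (P : Polynomial ℂ) {w : ℂ} (hw : 0 < w.re) :
    ∃ C : ℝ, ∀ x : ℝ, ‖P.eval (x : ℂ) * gauss w x‖ ≤ C := by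
  obtain ⟨C, -, h⟩ := exists_norm_eval_le_exp P (half_pos hw)
  refine ⟨C, fun x => ?_⟩
  rw [norm_mul, norm_gauss]
  calc _ ≤ C * Real.exp (w.re / 2 * x ^ 2) * Real.exp (-(w.re * x ^ 2) / 2) := by
        gcongr; exact h x
    _ = C := by rw [mul_assoc, ← Real.exp_add]; ring_nf; simp

/-- The Schwartz function `x ↦ P(x) exp (-w x² / 2)`, linear in the polynomial `P`. It is `0` by
convention when `w` does not have positive real part. -/
def gaussS (w : ℂ) : Polynomial ℂ →ₗ[ℂ] 𝓢(ℝ, ℂ) :=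
  if hw : 0 < w.re then
    { toFun := fun P =>
        { toFun := fun x : ℝ => P.eval (x : ℂ) * gauss w x
          smooth' := contDiff_eval_mul_gauss w P ⊤
          decay' := by
            intro k n
            obtain ⟨C, h⟩ := exists_norm_eval_mul_gauss_le
              (Polynomial.X ^ k * (polyDeriv w)^[n] P) hw
            refine ⟨C, fun x => ?_⟩
            rw [norm_iteratedFDeriv_eq_norm_iteratedDeriv, iteratedDeriv_eval_mul_gauss]
            refine le_trans (le_of_eq ?_) (h x)
            simp only [Polynomial.eval_mul, Polynomial.eval_pow, Polynomial.eval_X, norm_mul,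
              norm_pow, Complex.norm_real, mul_assoc] }
      map_add' := fun P Q => by
        ext x
        change (P + Q).eval (x : ℂ) * gauss w x = P.eval (x : ℂ) * gauss w x
          + Q.eval (x : ℂ) * gauss w x
        rw [Polynomial.eval_add, add_mul]
      map_smul' := fun c P => by
        ext x
        change (c • P).eval (x : ℂ) * gauss w x = c * (P.eval (x : ℂ) * gauss w x)
        rw [Polynomial.eval_smul, smul_eq_mul, mul_assoc] }
  else 0

theorem gaussS_apply {w : ℂ} (hw : 0 < w.re) (P : Polynomial ℂ) (x : ℝ) :
    gaussS w P x = P.eval (x : ℂ) * gauss w x := by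
  rw [gaussS, dif_pos hw]
  rfl

theorem mulX_gaussS {w : ℂ} (hw : 0 < w.re) (P : Polynomial ℂ) :
    mulX (gaussS w P) = gaussS w (Polynomial.X * P) := by
  ext x
  rw [mulX_apply, gaussS_apply hw, gaussS_apply hw, Polynomial.eval_mul, Polynomial.eval_X,
    mul_assoc]

theorem derivS_gaussS {w : ℂ} (hw : 0 < w.re) (P : Polynomial ℂ) :
    derivS (gaussS w P) = gaussS w (polyDeriv w P) := by
  ext x
  rw [derivS_apply, gaussS_apply hw, ← (hasDerivAt_eval_mul_gauss w P x).deriv]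
  congr 1
  exact funext (gaussS_apply hw P)

/-! ### Hermite functions with a complex scale -/

theorem derivative_hermiteH_succ (n : ℕ) :
    Polynomial.derivative (hermiteH (n + 1)) = ((2 * (n + 1) : ℕ) : Polynomial ℂ) * hermiteH n := by
  induction n with
  | zero => simp [hermiteH]
  | succ n ih =>
    have h : hermiteH (n + 1 + 1) = 2 * Polynomial.X * hermiteH (n + 1)
      - Polynomial.derivative (hermiteH (n + 1)) := rfl
    have h' : hermiteH (n + 1) = 2 * Polynomial.X * hermiteH n
      - Polynomial.derivative (hermiteH n) := rfl
    have h2 : Polynomial.derivative (2 * Polynomial.X : Polynomial ℂ) = 2 := by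
      rw [Polynomial.derivative_mul]; simp
    rw [h, Polynomial.derivative_sub, Polynomial.derivative_mul, h2, ih,
      Polynomial.derivative_mul, Polynomial.derivative_natCast]
    push_cast
    linear_combination -(2 * (n + 1) : Polynomial ℂ) * h'

/-- The polynomial `Hₙ (e^{iθ} x)`. -/
def hermP (θ : ℝ) (n : ℕ) : Polynomial ℂ :=
  (hermiteH n).comp (Polynomial.C (Complex.exp (Complex.I * θ)) * Polynomial.X)

theorem hermP_zero (θ : ℝ) : hermP θ 0 = 1 := by simp [hermP, hermiteH]

theorem derivative_hermP (θ : ℝ) (n : ℕ) : Polynomial.derivative (hermP θ n) =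
    Complex.exp (Complex.I * θ) • (Polynomial.derivative (hermiteH n)).comp
      (Polynomial.C (Complex.exp (Complex.I * θ)) * Polynomial.X) := by
  rw [hermP, Polynomial.derivative_comp, Polynomial.derivative_C_mul, Polynomial.derivative_X,
    mul_one, Polynomial.smul_eq_C_mul]

theorem derivative_hermP_succ (θ : ℝ) (n : ℕ) : Polynomial.derivative (hermP θ (n + 1)) =
    (Complex.exp (Complex.I * θ) * (2 * (n + 1))) • hermP θ n := by
  rw [derivative_hermP, derivative_hermiteH_succ, Polynomial.mul_comp, Polynomial.natCast_comp,
    mul_smul, hermP, ← nsmul_eq_mul, ← Nat.cast_smul_eq_nsmul ℂ]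
  push_cast
  rfl

/-- The recursion of the Hermite polynomials, in the scaled variable. -/
theorem hermP_succ (θ : ℝ) (n : ℕ) : hermP θ (n + 1) =
    (2 * Complex.exp (Complex.I * θ)) • (Polynomial.X * hermP θ n)
      - Complex.exp (-(Complex.I * θ)) • Polynomial.derivative (hermP θ n) := by
  rw [derivative_hermP, smul_smul, mul_comm (Complex.exp (-_)), exp_I_mul_mul_exp_neg, one_smul,
    hermP, hermP, hermiteH, Polynomial.sub_comp, Polynomial.mul_comp, Polynomial.mul_comp,
    Polynomial.X_comp, Polynomial.smul_eq_C_mul, Polynomial.C_mul]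
  simp only [Polynomial.ofNat_comp, Polynomial.C_ofNat]
  ring

/-- The recursion shows that the span of the `Hₙ (e^{iθ} x)` is stable under multiplication by `x`.
-/
theorem span_range_hermP (θ : ℝ) : Submodule.span ℂ (Set.range (hermP θ)) = ⊤ := by
  set M := Submodule.span ℂ (Set.range (hermP θ))
  have hmem : ∀ n, hermP θ n ∈ M := fun n => Submodule.subset_span ⟨n, rfl⟩
  have hder : ∀ n, Polynomial.derivative (hermP θ n) ∈ M := by
    rintro (_ | n)
    · simp [hermP_zero]
    · rw [derivative_hermP_succ]
      exact M.smul_mem _ (hmem n)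
  have hX : ∀ P ∈ M, Polynomial.X * P ∈ M := by
    intro P hP
    induction hP using Submodule.span_induction with
    | mem P h =>
      obtain ⟨n, rfl⟩ := h
      have h := hermP_succ θ n
      have h' : Polynomial.X * hermP θ n = (2 * Complex.exp (Complex.I * θ))⁻¹ •
          (hermP θ (n + 1) + Complex.exp (-(Complex.I * θ)) •
            Polynomial.derivative (hermP θ n)) := by
        rw [h, sub_add_cancel, inv_smul_smul₀]
        exact mul_ne_zero two_ne_zero (Complex.exp_ne_zero _)
      rw [h']
      exact M.smul_mem _ (M.add_mem (hmem _) (M.smul_mem _ (hder n)))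
    | zero => simp
    | add P Q _ _ hP hQ => rw [mul_add]; exact M.add_mem hP hQ
    | smul c P _ hP => rw [mul_smul_comm]; exact M.smul_mem _ hP
  have hpow : ∀ n, (Polynomial.X : Polynomial ℂ) ^ n ∈ M := by
    intro n
    induction n with
    | zero => rw [pow_zero, ← hermP_zero θ]; exact hmem 0
    | succ n ih => rw [pow_succ']; exact hX _ ih
  rw [eq_top_iff]
  rintro P -
  induction P using Polynomial.induction_on' with
  | add P Q hP hQ => exact M.add_mem hP hQ
  | monomial n a =>
    rw [← Polynomial.C_mul_X_pow_eq_monomial, ← Polynomial.smul_eq_C_mul]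
    exact M.smul_mem _ (hpow n)

theorem exp_two_I_mul (θ : ℝ) :
    Complex.exp (2 * Complex.I * θ) =
      Complex.exp (Complex.I * θ) * Complex.exp (Complex.I * θ) := by
  rw [← Complex.exp_add]
  ring_nf

theorem exp_two_I_mul_re (θ : ℝ) : (Complex.exp (2 * Complex.I * θ)).re = Real.cos (2 * θ) := by
  have : 2 * Complex.I * (θ : ℂ) = ((2 * θ : ℝ) : ℂ) * Complex.I := by push_cast; ring
  rw [this, Complex.exp_ofReal_mul_I_re]

/-- The normalized Hermite function with complex scale `e^{iθ}`. It gives `φₙ` for the angle `θ`,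
`Ψₙ` for `-θ` and `eₙ` for the angle `0`. -/
def phiS (θ : ℝ) (N : ℂ) (n : ℕ) : 𝓢(ℝ, ℂ) :=
  (N / (Real.sqrt (2 ^ n * n.factorial) : ℂ)) • gaussS (Complex.exp (2 * Complex.I * θ)) (hermP θ n)

section Ladder

variable {θ : ℝ} (hθ : 0 < Real.cos (2 * θ)) (N : ℂ) (n : ℕ)

include hθ

theorem phiS_apply (x : ℝ) : phiS θ N n x = hermiteFun θ N n x := by
  have hw : 0 < (Complex.exp (2 * Complex.I * θ)).re := by rwa [exp_two_I_mul_re]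
  rw [phiS, smul_apply, gaussS_apply hw, hermiteFun, hermP, gauss, Polynomial.eval_comp,
    smul_eq_mul, Polynomial.eval_mul, Polynomial.eval_C, Polynomial.eval_X]
  ring

theorem lowerS_gaussS (P : Polynomial ℂ) :
    lowerS θ (gaussS (Complex.exp (2 * Complex.I * θ)) P) =
      gaussS (Complex.exp (2 * Complex.I * θ)) (((Real.sqrt 2 : ℂ)⁻¹ *
        Complex.exp (-(Complex.I * θ))) • Polynomial.derivative P) := by
  have hw : 0 < (Complex.exp (2 * Complex.I * θ)).re := by rwa [exp_two_I_mul_re]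
  rw [lowerS, ladder_apply, mulX_gaussS hw, derivS_gaussS hw, ← map_smul, ← map_smul, ← map_add,
    ← map_smul, polyDeriv, ← Polynomial.smul_eq_C_mul, exp_two_I_mul]
  congr 1
  have h := exp_I_mul_mul_exp_neg θ
  match_scalars
  · linear_combination -(Real.sqrt 2 : ℂ)⁻¹ * Complex.exp (Complex.I * θ) * h
  · ring

theorem raiseS_gaussS_hermP :
    raiseS θ (gaussS (Complex.exp (2 * Complex.I * θ)) (hermP θ n)) =
      (Real.sqrt 2 : ℂ)⁻¹ • gaussS (Complex.exp (2 * Complex.I * θ)) (hermP θ (n + 1)) := by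
  have hw : 0 < (Complex.exp (2 * Complex.I * θ)).re := by rwa [exp_two_I_mul_re]
  rw [raiseS, ladder_apply, mulX_gaussS hw, derivS_gaussS hw, ← map_smul, ← map_smul, ← map_add,
    polyDeriv, ← Polynomial.smul_eq_C_mul, exp_two_I_mul, hermP_succ]
  congr 2
  have h := exp_I_mul_mul_exp_neg θ
  match_scalars
  · linear_combination Complex.exp (Complex.I * θ) * h
  · ring

end Ladder

theorem sqrt_two_pow_factorial_succ (n : ℕ) : (Real.sqrt (2 ^ (n + 1) * (n + 1).factorial) : ℂ) =
    Real.sqrt 2 * Real.sqrt (n + 1) * Real.sqrt (2 ^ n * n.factorial) := by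
  rw [← Complex.ofReal_mul, ← Complex.ofReal_mul, ← Real.sqrt_mul (by norm_num),
    ← Real.sqrt_mul (by positivity)]
  congr 2
  push_cast [Nat.factorial_succ]
  ring

theorem sqrt_succ_ne_zero (n : ℕ) : (Real.sqrt (n + 1) : ℂ) ≠ 0 :=
  Complex.ofReal_ne_zero.2 (Real.sqrt_ne_zero'.2 (by positivity))

theorem sqrt_succ_mul_self (n : ℕ) : (Real.sqrt (n + 1) : ℂ) * Real.sqrt (n + 1) = n + 1 := by
  rw [← Complex.ofReal_mul, Real.mul_self_sqrt (by positivity)]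
  push_cast
  rfl

theorem lowerS_phiS_zero {θ : ℝ} (hθ : 0 < Real.cos (2 * θ)) (N : ℂ) :
    lowerS θ (phiS θ N 0) = 0 := by
  rw [phiS, map_smul, lowerS_gaussS hθ, hermP_zero]
  simp

theorem lowerS_phiS_succ {θ : ℝ} (hθ : 0 < Real.cos (2 * θ)) (N : ℂ) (n : ℕ) :
    lowerS θ (phiS θ N (n + 1)) = (Real.sqrt (n + 1) : ℂ) • phiS θ N n := by
  rw [phiS, map_smul, lowerS_gaussS hθ, derivative_hermP_succ, phiS, sqrt_two_pow_factorial_succ]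
  simp only [map_smul, smul_smul]
  congr 1
  have h := exp_I_mul_mul_exp_neg θ
  have h1 := sqrt_succ_ne_zero n
  have h2 : (Real.sqrt 2 : ℂ) ≠ 0 := by simp
  have h3 : (Real.sqrt (2 ^ n * n.factorial) : ℂ) ≠ 0 :=
    Complex.ofReal_ne_zero.2 (Real.sqrt_ne_zero'.2 (by positivity))
  have h4 := sqrt_succ_mul_self n
  have h5 : (Real.sqrt 2 : ℂ) ^ 2 = 2 := by
    rw [← Complex.ofReal_pow, Real.sq_sqrt (by norm_num)]; norm_num
  field_simp
  rw [h5]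
  linear_combination (N * 2 * (n + 1)) * h - 2 * N * h4

theorem raiseS_phiS {θ : ℝ} (hθ : 0 < Real.cos (2 * θ)) (N : ℂ) (n : ℕ) :
    raiseS θ (phiS θ N n) = (Real.sqrt (n + 1) : ℂ) • phiS θ N (n + 1) := by
  rw [phiS, map_smul, raiseS_gaussS_hermP hθ, phiS, sqrt_two_pow_factorial_succ]
  simp only [smul_smul]
  congr 1
  have h1 := sqrt_succ_ne_zero n
  have h2 : (Real.sqrt 2 : ℂ) ≠ 0 := by simp
  have h3 : (Real.sqrt (2 ^ n * n.factorial) : ℂ) ≠ 0 :=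
    Complex.ofReal_ne_zero.2 (Real.sqrt_ne_zero'.2 (by positivity))
  field_simp

/-- The Gaussian integral which fixes the normalization `N̄₁ N₂`. -/
theorem inner_phiS_zero {θ : ℝ} (hθ : 0 < Real.cos (2 * θ)) (hθ' : 0 < Real.cos θ) (N₁ N₂ : ℂ) :
    inner ℂ (toL2 (phiS θ N₁ 0)) (toL2 (phiS (-θ) N₂ 0)) =
      (starRingEnd ℂ) N₁ * N₂ * (Real.sqrt Real.pi * Complex.exp (Complex.I * θ)) := by
  have hθn : 0 < Real.cos (2 * -θ) := by rwa [mul_neg, Real.cos_neg]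
  have hw : 0 < (Complex.exp (2 * Complex.I * (-θ : ℝ))).re := by rwa [exp_two_I_mul_re]
  have hconj : (starRingEnd ℂ) (Complex.exp (2 * Complex.I * θ)) =
      Complex.exp (2 * Complex.I * (-θ : ℝ)) := by
    rw [← Complex.exp_conj]
    congr 1
    simp only [map_mul, Complex.conj_I, Complex.conj_ofReal, Complex.conj_ofNat]
    push_cast
    ring
  have hint : ∀ x : ℝ, (starRingEnd ℂ) (phiS θ N₁ 0 x) * phiS (-θ) N₂ 0 x =
      (starRingEnd ℂ) N₁ * N₂ *
        Complex.exp (-(Complex.exp (2 * Complex.I * (-θ : ℝ))) * (x : ℂ) ^ 2) := by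
    intro x
    rw [phiS_apply hθ, phiS_apply hθn]
    simp only [hermiteFun, hermiteH, Polynomial.eval_one, pow_zero, Nat.factorial_zero,
      Nat.cast_one, mul_one, Real.sqrt_one, Complex.ofReal_one, div_one, map_mul,
      ← Complex.exp_conj, map_div₀, map_neg, map_pow, Complex.conj_ofReal, hconj, map_ofNat]
    rw [mul_mul_mul_comm, ← Complex.exp_add]
    congr 2
    ring
  rw [inner_toL2]
  simp only [hint]
  rw [MeasureTheory.integral_const_mul, integral_gaussian_complex hw]
  congr 1
  have h2 : (Real.pi : ℂ) / Complex.exp (2 * Complex.I * (-θ : ℝ)) =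
      (Real.sqrt Real.pi * Complex.exp (Complex.I * θ)) ^ 2 := by
    rw [mul_pow, ← Complex.ofReal_pow, Real.sq_sqrt Real.pi_pos.le, div_eq_mul_inv,
      ← Complex.exp_neg, ← Complex.exp_nat_mul]
    congr 2
    push_cast
    ring
  -- the square root is the principal one because `cos θ > 0`
  rw [h2, one_div, Complex.sq_cpow_two_inv]
  rw [Complex.re_ofReal_mul]
  refine mul_pos (Real.sqrt_pos.2 Real.pi_pos) ?_
  rw [mul_comm, Complex.exp_ofReal_mul_I_re]
  exact hθ'

end Swanson

namespace Swanson

/-! ### Completeness of polynomials times a Gaussian -/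

open MeasureTheory FourierTransform

/-- An integrable function with vanishing Fourier transform is zero: test it against Schwartz
functions, all of which are Fourier transforms. -/
theorem ae_eq_zero_of_fourier_eq_zero {c : ℝ → ℂ} (hc : Integrable c) (h : ∀ ξ, 𝓕 c ξ = 0) :
    ∀ᵐ x, c x = 0 := by
  have hS : ∀ η : 𝓢(ℝ, ℂ), ∫ x, c x * η x = 0 := by
    intro η
    have h1 := VectorFourier.integral_fourierIntegral_smul_eq_flip (L := innerₗ ℝ) (μ := volume)
      (ν := volume) Real.continuous_fourierChar continuous_inner hc (𝓕⁻ η).integrable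
    have h2 : ∫ ξ, 𝓕 c ξ * (𝓕⁻ η) ξ = ∫ x, c x * 𝓕 (𝓕⁻ η) x := by
      rw [flip_innerₗ] at h1
      exact h1
    simp only [h, zero_mul, integral_zero] at h2
    rw [FourierTransform.fourier_fourierInv_eq] at h2
    exact h2.symm
  refine ae_eq_zero_of_integral_contDiff_smul_eq_zero hc.locallyIntegrable fun g hg hgc => ?_
  have hg₁ : HasCompactSupport (Complex.ofRealCLM ∘ g) := hgc.comp_left rfl
  have hg₂ : ContDiff ℝ (⊤ : ℕ∞) (Complex.ofRealCLM ∘ g) := by fun_prop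
  rw [← hS (hg₁.toSchwartzMap hg₂)]
  congr 1
  funext x
  rw [mul_comm]
  rfl

/-- A square integrable function times a Gaussian has all exponential moments. -/
theorem integrable_exp_mul_abs_mul_gauss_mul {w : ℂ} (hw : 0 < w.re) (g : L2) (a : ℝ) :
    Integrable (fun x : ℝ => Real.exp (a * |x|) * ‖(starRingEnd ℂ) (gauss w x) * g x‖) := by
  have hw' : 0 < ((w.re / 2 : ℝ) : ℂ).re := by simpa using hw
  have hm := (gaussS ((w.re / 2 : ℝ) : ℂ) 1).memLp 2 volume
  have hcont : Continuous (fun x : ℝ => Real.exp (a * |x|) * ‖gauss w x‖) := by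
    unfold gauss
    fun_prop
  have h1 : MemLp (fun x : ℝ => Real.exp (a * |x|) * ‖gauss w x‖) 2 volume := by
    refine hm.of_le_mul (c := Real.exp (a ^ 2 / w.re)) hcont.aestronglyMeasurable
      (Filter.Eventually.of_forall fun x => ?_)
    rw [gaussS_apply hw', Polynomial.eval_one, one_mul, norm_gauss, norm_gauss,
      Real.norm_of_nonneg (by positivity), ← Real.exp_add, ← Real.exp_add]
    refine Real.exp_le_exp.2 ?_
    have h2 : 0 ≤ w.re / 4 * (|x| - 2 * a / w.re) ^ 2 := by positivity
    have h3 : w.re / 4 * (|x| - 2 * a / w.re) ^ 2 = w.re / 4 * x ^ 2 - a * |x| + a ^ 2 / w.re := by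
      rw [← sq_abs x]
      field_simp
      ring
    rw [Complex.ofReal_re]
    linarith
  have h2 := (h1.integrable_mul (Lp.memLp g).norm)
  refine h2.congr (Filter.Eventually.of_forall fun x => ?_)
  simp only [Pi.mul_apply, norm_mul, RCLike.norm_conj]
  ring

/-- The functions `P(x) exp (-w x² / 2)` are total in `L²(ℝ)`: if `g` is orthogonal to all of them
then, expanding the exponential into its power series, the Fourier transform of `g` times the
Gaussian vanishes. -/
theorem eq_zero_of_inner_gaussS {w : ℂ} (hw : 0 < w.re) {g : L2}
    (h : ∀ P, inner ℂ (toL2 (gaussS w P)) g = 0) : g = 0 := by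
  set c : ℝ → ℂ := fun x => (starRingEnd ℂ) (gauss w x) * g x with hc
  have hmeas : AEStronglyMeasurable c := by
    refine AEStronglyMeasurable.mul (Continuous.aestronglyMeasurable ?_) (Lp.aestronglyMeasurable g)
    unfold gauss
    fun_prop
  have hexp := integrable_exp_mul_abs_mul_gauss_mul hw g
  have hint : Integrable c := by
    rw [← integrable_norm_iff hmeas]
    simpa only [zero_mul, Real.exp_zero, one_mul] using hexp 0
  have hmom : ∀ n : ℕ, ∫ x : ℝ, (x : ℂ) ^ n * c x = 0 := by
    intro n
    rw [← h (Polynomial.X ^ n)]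
    refine integral_congr_ae ?_
    filter_upwards [SchwartzMap.coeFn_toLp (gaussS w (Polynomial.X ^ n)) 2 volume] with x hx
    have hx' : toL2 (gaussS w (Polynomial.X ^ n)) x = gaussS w (Polynomial.X ^ n) x := hx
    rw [hx', gaussS_apply hw, Polynomial.eval_pow, Polynomial.eval_X, hc, RCLike.inner_apply,
      map_mul, map_pow, Complex.conj_ofReal]
    ring
  have hF : ∀ ξ, 𝓕 c ξ = 0 := by
    intro ξ
    rw [Real.fourier_real_eq_integral_exp_smul]
    set z : ℂ := ((-2 * Real.pi * ξ : ℝ) : ℂ) * Complex.I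
    have hs := hasSum_integral_of_dominated_convergence (μ := volume)
      (F := fun (n : ℕ) (x : ℝ) => z ^ n / n.factorial * ((x : ℂ) ^ n * c x))
      (f := fun x : ℝ => Complex.exp (((-2 * Real.pi * x * ξ : ℝ) : ℂ) * Complex.I) • c x)
      (fun (n : ℕ) (x : ℝ) => (‖z‖ * |x|) ^ n / n.factorial * ‖c x‖)
      (fun n => ?_) (fun n => ?_) ?_ ?_ ?_
    · simp only [integral_const_mul, hmom, mul_zero] at hs
      exact hs.unique hasSum_zero
    · refine AEStronglyMeasurable.const_mul (AEStronglyMeasurable.mul ?_ hmeas) _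
      exact Continuous.aestronglyMeasurable (by fun_prop)
    · refine Filter.Eventually.of_forall fun x => le_of_eq ?_
      simp only [norm_mul, norm_div, norm_pow, Complex.norm_real, Real.norm_eq_abs,
        Complex.norm_natCast]
      ring
    · refine Filter.Eventually.of_forall fun x => ?_
      exact (Real.summable_pow_div_factorial _).mul_right _
    · refine (hexp ‖z‖).congr (Filter.Eventually.of_forall fun x => ?_)
      dsimp only
      rw [tsum_mul_right, Real.exp_eq_exp_ℝ, NormedSpace.exp_eq_tsum_div]
    · refine Filter.Eventually.of_forall fun x => ?_
      have h1 : ((-2 * Real.pi * x * ξ : ℝ) : ℂ) * Complex.I = z * x := by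
        simp only [z]
        push_cast
        ring
      rw [h1, smul_eq_mul, Complex.exp_eq_exp_ℂ]
      have h2 := (NormedSpace.expSeries_div_hasSum_exp (z * x)).mul_right (c x)
      refine h2.congr_fun fun n => ?_
      rw [mul_pow]
      ring
  rw [Lp.eq_zero_iff_ae_eq_zero]
  filter_upwards [ae_eq_zero_of_fourier_eq_zero hint hF] with x hx
  have : gauss w x ≠ 0 := Complex.exp_ne_zero _
  simpa [hc, this] using hx

/-- The Hermite functions of a fixed complex scale are total in `L²(ℝ)`. -/
theorem eq_zero_of_inner_phiS {θ : ℝ} (hθ : 0 < Real.cos (2 * θ)) {N : ℂ} (hN : N ≠ 0) {g : L2}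
    (h : ∀ n, inner ℂ (toL2 (phiS θ N n)) g = 0) : g = 0 := by
  have hw : 0 < (Complex.exp (2 * Complex.I * θ)).re := by rwa [exp_two_I_mul_re]
  refine eq_zero_of_inner_gaussS hw fun P => ?_
  have hP : P ∈ Submodule.span ℂ (Set.range (hermP θ)) := by
    rw [span_range_hermP]
    trivial
  induction hP using Submodule.span_induction with
  | mem P hP =>
    obtain ⟨n, rfl⟩ := hP
    have h1 := h n
    rw [phiS, map_smul, inner_smul_left, mul_eq_zero] at h1
    refine h1.resolve_left ?_
    exact (map_ne_zero _).2
      (div_ne_zero hN (Complex.ofReal_ne_zero.2 (Real.sqrt_ne_zero'.2 (by positivity))))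
  | zero => simp
  | add P Q _ _ hP hQ => rw [map_add, map_add, inner_add_left, hP, hQ, add_zero]
  | smul c P _ hP => rw [map_smul, map_smul, inner_smul_left, hP, mul_zero]

theorem isCompleteFamily_of_inner {E : Type*} [NormedAddCommGroup E] [InnerProductSpace ℂ E]
    [CompleteSpace E] {f : ℕ → E} (h : ∀ g, (∀ n, inner ℂ (f n) g = 0) → g = 0) :
    IsCompleteFamily f := by
  rw [IsCompleteFamily, Submodule.dense_iff_topologicalClosure_eq_top,
    Submodule.topologicalClosure_eq_top_iff, Submodule.eq_bot_iff]
  intro g hg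
  exact h g fun n => (Submodule.mem_orthogonal _ _).1 hg _ (Submodule.subset_span ⟨n, rfl⟩)

end Swanson

namespace Swanson

/-! ### Complex dilations of polynomials times a Gaussian -/

open MeasureTheory

theorem norm_toL2_sq (f : 𝓢(ℝ, ℂ)) : ‖toL2 f‖ ^ 2 = ∫ x, ‖f x‖ ^ 2 := by
  have h := inner_self_eq_norm_sq (𝕜 := ℂ) (toL2 f)
  rw [inner_toL2] at h
  have h1 : ∀ x, (starRingEnd ℂ) (f x) * f x = ((‖f x‖ ^ 2 : ℝ) : ℂ) := by
    intro x
    rw [Complex.conj_mul']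
    push_cast
    rfl
  simp only [h1] at h
  rw [integral_complex_ofReal] at h
  exact h.symm

theorem norm_toL2_le_mul {f g : 𝓢(ℝ, ℂ)} {c : ℝ} (h : ∀ x, ‖f x‖ ≤ c * ‖g x‖) :
    ‖toL2 f‖ ≤ c * ‖toL2 g‖ := by
  refine Lp.norm_le_mul_norm_of_ae_le_mul ?_
  filter_upwards [SchwartzMap.coeFn_toLp f 2 volume, SchwartzMap.coeFn_toLp g 2 volume]
    with x hf hg
  have hf' : toL2 f x = f x := hf
  have hg' : toL2 g x = g x := hg
  rw [hf', hg']
  exact h x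

theorem gauss_add (w h : ℂ) (x : ℝ) :
    gauss (w + h) x = gauss w x * Complex.exp (-(h * (x : ℂ) ^ 2) / 2) := by
  rw [gauss, gauss, ← Complex.exp_add]
  congr 1
  ring

/-- The map `w ↦ P(x) exp (-w x² / 2)` is holomorphic with values in `L²(ℝ)`: the second order
Taylor remainder at `w + h` is dominated by `|h|² |P(x)| x⁴ exp (-w.re x² / 4) / 4` for `|h| ≤ w.re
/ 2`. -/
theorem hasDerivAt_toL2_gaussS (P : Polynomial ℂ) {w : ℂ} (hw : 0 < w.re) :
    HasDerivAt (fun w => toL2 (gaussS w P))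
      (toL2 (gaussS w (-(1 / 2 : ℂ) • (Polynomial.X ^ 2 * P)))) w := by
  rw [hasDerivAt_iff_isLittleO_nhds_zero]
  have hw2 : 0 < ((w.re / 2 : ℝ) : ℂ).re := by simpa using hw
  set G := gaussS ((w.re / 2 : ℝ) : ℂ) ((1 / 4 : ℂ) • (Polynomial.X ^ 4 * P))
  refine Asymptotics.IsBigO.trans_isLittleO (g := fun h : ℂ => h ^ 2) ?_
    (Asymptotics.isLittleO_pow_id one_lt_two)
  refine Asymptotics.IsBigO.of_bound ‖toL2 G‖ ?_
  filter_upwards [Metric.ball_mem_nhds (0 : ℂ) (half_pos hw)] with h hh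
  have hh' : ‖h‖ ≤ w.re / 2 := by
    rw [mem_ball_zero_iff] at hh
    exact hh.le
  have hwh : 0 < (w + h).re := by
    rw [mem_ball_zero_iff] at hh
    have := (abs_le.1 (Complex.abs_re_le_norm h)).1
    rw [Complex.add_re]
    linarith
  rw [← map_sub, ← map_smul, ← map_sub, norm_pow, mul_comm ‖toL2 G‖]
  refine norm_toL2_le_mul fun x => ?_
  have hx : (gaussS (w + h) P - gaussS w P -
      h • gaussS w (-(1 / 2 : ℂ) • (Polynomial.X ^ 2 * P))) x =
      P.eval (x : ℂ) * gauss w x * (Complex.exp (-(h * (x : ℂ) ^ 2) / 2)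
        - ∑ m ∈ Finset.range 2, (-(h * (x : ℂ) ^ 2) / 2) ^ m / m.factorial) := by
    rw [sub_apply, sub_apply, smul_apply, gaussS_apply hwh, gaussS_apply hw, gaussS_apply hw,
      gauss_add]
    simp only [Finset.sum_range_succ, Finset.sum_range_zero, Polynomial.eval_smul,
      Polynomial.eval_mul, Polynomial.eval_pow, Polynomial.eval_X, smul_eq_mul, Nat.factorial]
    push_cast
    ring
  have hu : ‖-(h * (x : ℂ) ^ 2) / 2‖ = ‖h‖ * x ^ 2 / 2 := by
    simp [Complex.norm_real]
  have hG : ‖G x‖ = ‖P.eval (x : ℂ)‖ * (x ^ 4 / 4) * Real.exp (-(w.re / 2 * x ^ 2) / 2) := by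
    have hx4 : ‖(x : ℂ) ^ 4‖ = x ^ 4 := by
      rw [norm_pow, Complex.norm_real, Real.norm_eq_abs]
      exact Even.pow_abs (by decide) x
    rw [gaussS_apply hw2, norm_mul, norm_gauss, Polynomial.eval_smul, Polynomial.eval_mul,
      Polynomial.eval_pow, Polynomial.eval_X, norm_smul, norm_mul, hx4, Complex.ofReal_re]
    norm_num
    ring
  rw [hx, norm_mul, norm_mul, norm_gauss, hG]
  have h3 := Complex.norm_exp_sub_sum_le_norm_mul_exp (-(h * (x : ℂ) ^ 2) / 2) 2
  rw [hu] at h3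
  calc ‖P.eval (x : ℂ)‖ * Real.exp (-(w.re * x ^ 2) / 2) * _
      ≤ ‖P.eval (x : ℂ)‖ * Real.exp (-(w.re * x ^ 2) / 2) *
        ((‖h‖ * x ^ 2 / 2) ^ 2 * Real.exp (w.re / 2 * x ^ 2 / 2)) := by
        refine mul_le_mul_of_nonneg_left (h3.trans ?_) (by positivity)
        gcongr
    _ = ‖h‖ ^ 2 * (‖P.eval (x : ℂ)‖ * (x ^ 4 / 4) * (Real.exp (-(w.re * x ^ 2) / 2) *
          Real.exp (w.re / 2 * x ^ 2 / 2))) := by ring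
    _ = _ := by
        rw [← Real.exp_add]
        ring_nf

/-- The open strip on which complex dilations of the Gaussian `exp (-x² / 2)` stay in `L²(ℝ)`. -/
def strip : Set ℂ := {ζ | |ζ.im| < Real.pi / 4}

theorem isOpen_strip : IsOpen strip := by
  unfold strip
  exact isOpen_lt (by fun_prop) continuous_const

theorem exp_two_mul_re_pos {ζ : ℂ} (h : ζ ∈ strip) : 0 < (Complex.exp (2 * ζ)).re := by
  rw [Complex.exp_re]
  have h' := abs_lt.1 (show |ζ.im| < Real.pi / 4 from h)
  refine mul_pos (Real.exp_pos _) (Real.cos_pos_of_mem_Ioo ⟨?_, ?_⟩)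
  · simp only [Complex.mul_im, Complex.re_ofNat, Complex.im_ofNat, zero_mul, add_zero]
    linarith
  · simp only [Complex.mul_im, Complex.re_ofNat, Complex.im_ofNat, zero_mul, add_zero]
    linarith

/-- The complex dilation `f(x) ↦ e^{ζ/2} f(e^ζ x)` applied to `f(x) = P(x) exp (-x² / 2)`. -/
def dilGauss (ζ : ℂ) (P : Polynomial ℂ) : 𝓢(ℝ, ℂ) :=
  Complex.exp (ζ / 2) • gaussS (Complex.exp (2 * ζ))
    (P.comp (Polynomial.C (Complex.exp ζ) * Polynomial.X))

theorem dilGauss_zero (P : Polynomial ℂ) : dilGauss 0 P = gaussS 1 P := by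
  simp [dilGauss]

theorem dilGauss_add (ζ : ℂ) (P Q : Polynomial ℂ) :
    dilGauss ζ (P + Q) = dilGauss ζ P + dilGauss ζ Q := by
  rw [dilGauss, Polynomial.add_comp, map_add, smul_add, dilGauss, dilGauss]

theorem dilGauss_monomial (ζ : ℂ) (n : ℕ) (a : ℂ) : dilGauss ζ (Polynomial.monomial n a) =
    (a * Complex.exp ((n + 1 / 2) * ζ)) • gaussS (Complex.exp (2 * ζ)) (Polynomial.X ^ n) := by
  rw [dilGauss, Polynomial.monomial_comp, mul_pow, ← Polynomial.C_pow, ← mul_assoc,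
    ← Polynomial.C_mul, ← Polynomial.smul_eq_C_mul, map_smul, smul_smul, ← Complex.exp_nat_mul]
  congr 1
  rw [mul_left_comm, ← Complex.exp_add]
  ring_nf

/-- The action of `x d/dx + 1/2` on `P(x) exp (-x² / 2)`, in terms of the polynomial `P`. -/
def polyDil (P : Polynomial ℂ) : Polynomial ℂ :=
  (1 / 2 : ℂ) • P + Polynomial.X * Polynomial.derivative P - Polynomial.X ^ 2 * P

theorem dilS_gaussS (P : Polynomial ℂ) : dilS (gaussS 1 P) = gaussS 1 (polyDil P) := by
  have h1 : 0 < (1 : ℂ).re := by simp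
  simp only [dilS, LinearMap.add_apply, LinearMap.comp_apply, LinearMap.smul_apply,
    LinearMap.id_apply, derivS_gaussS h1, mulX_gaussS h1]
  rw [← map_smul, ← map_add]
  congr 1
  rw [polyDil, polyDeriv, Polynomial.C_1]
  ring

/-- The orbit `ζ ↦ e^{ζ (x d/dx + 1/2)} f` of a polynomial times a Gaussian under complex dilations
is holomorphic on the strip `|Im ζ| < π / 4`. -/
theorem hasDerivAt_toL2_dilGauss (P : Polynomial ℂ) {ζ : ℂ} (hζ : ζ ∈ strip) :
    HasDerivAt (fun ζ => toL2 (dilGauss ζ P)) (toL2 (dilGauss ζ (polyDil P))) ζ := by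
  induction P using Polynomial.induction_on' with
  | add P Q hP hQ =>
    have : polyDil (P + Q) = polyDil P + polyDil Q := by
      simp only [polyDil, smul_add, Polynomial.derivative_add]
      ring
    simp only [this, dilGauss_add, map_add]
    exact hP.add hQ
  | monomial n a =>
    have hw := exp_two_mul_re_pos hζ
    have h1 : HasDerivAt (fun ζ : ℂ => Complex.exp (2 * ζ)) (Complex.exp (2 * ζ) * (2 * 1)) ζ :=
      ((hasDerivAt_id ζ).const_mul 2).cexp
    have h2 := (hasDerivAt_toL2_gaussS (Polynomial.X ^ n) hw).scomp ζ h1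
    have h3 : HasDerivAt (fun ζ : ℂ => a * Complex.exp ((n + 1 / 2) * ζ))
        (a * (Complex.exp ((n + 1 / 2) * ζ) * ((n + 1 / 2) * 1))) ζ :=
      (((hasDerivAt_id ζ).const_mul ((n : ℂ) + 1 / 2)).cexp).const_mul a
    have h4 := h3.smul h2
    have hpoly : polyDil (Polynomial.monomial n a) =
        Polynomial.monomial n (((n : ℂ) + 1 / 2) * a) + Polynomial.monomial (n + 2) (-a) := by
      have hd : Polynomial.X * Polynomial.derivative (Polynomial.monomial n a) =
          Polynomial.monomial n ((n : ℂ) * a) := by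
        cases n with
        | zero => simp
        | succ n =>
          rw [Polynomial.derivative_monomial, Polynomial.X_mul_monomial, Nat.add_sub_cancel,
            mul_comm a]
      rw [polyDil, hd, Polynomial.X_pow_mul_monomial, Polynomial.smul_monomial, ← map_add,
        sub_eq_add_neg, ← map_neg, smul_eq_mul]
      congr 2
      ring
    rw [hpoly, dilGauss_add, dilGauss_monomial, dilGauss_monomial]
    simp only [dilGauss_monomial, map_smul, map_add]
    refine h4.congr_deriv ?_
    simp only [Function.comp_apply, map_smul, ← pow_add, smul_smul]
    rw [add_comm, add_comm 2 n]
    congr 2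
    · ring
    · have : Complex.exp (((n + 2 : ℕ) + 1 / 2) * ζ) =
          Complex.exp ((n + 1 / 2) * ζ) * Complex.exp (2 * ζ) := by
        rw [← Complex.exp_add]
        congr 1
        push_cast
        ring
      rw [this]
      ring

theorem iteratedDeriv_toL2_dilGauss (P : Polynomial ℂ) (k : ℕ) {ζ : ℂ} (hζ : ζ ∈ strip) :
    iteratedDeriv k (fun ζ => toL2 (dilGauss ζ P)) ζ = toL2 (dilGauss ζ (polyDil^[k] P)) := by
  induction k generalizing ζ with
  | zero => rfl
  | succ k ih =>
    rw [iteratedDeriv_succ, Function.iterate_succ_apply',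
      ← (hasDerivAt_toL2_dilGauss (polyDil^[k] P) hζ).deriv]
    refine Filter.EventuallyEq.deriv_eq ?_
    filter_upwards [isOpen_strip.mem_nhds hζ] with z hz
    exact ih hz

theorem ball_subset_strip : Metric.ball (0 : ℂ) (Real.pi / 4) ⊆ strip := by
  intro z hz
  rw [mem_ball_zero_iff] at hz
  exact (Complex.abs_im_le_norm z).trans_lt hz

theorem hasSum_toL2_dilGauss (P : Polynomial ℂ) {z : ℂ} (hz : ‖z‖ < Real.pi / 4) :
    HasSum (fun n : ℕ => ((n.factorial : ℂ))⁻¹ • z ^ n • toL2 (gaussS 1 (polyDil^[n] P)))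
      (toL2 (dilGauss z P)) := by
  have h := Complex.hasSum_taylorSeries_on_ball (f := fun ζ => toL2 (dilGauss ζ P)) (c := 0)
    (r := Real.pi / 4) (z := z)
    (fun ζ hζ => ((hasDerivAt_toL2_dilGauss P
      (ball_subset_strip hζ)).differentiableAt).differentiableWithinAt)
    (by simpa using hz)
  have h0 : (0 : ℂ) ∈ strip := ball_subset_strip (Metric.mem_ball_self (by positivity))
  simpa only [iteratedDeriv_toL2_dilGauss P _ h0, sub_zero, dilGauss_zero] using h

/-- A power series which converges on a disc converges absolutely inside. -/
theorem summable_norm_of_hasSum_on_ball {E : Type*} [NormedAddCommGroup E] [NormedSpace ℂ E]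
    {v : ℕ → E} {R : ℝ}
    (h : ∀ z : ℂ, ‖z‖ < R → Summable fun n : ℕ => ((n.factorial : ℂ))⁻¹ • z ^ n • v n)
    {z : ℂ} (hz : ‖z‖ < R) : Summable fun n : ℕ => ‖z ^ n • v n‖ / n.factorial := by
  obtain ⟨ρ, hρ1, hρ2⟩ := exists_between hz
  have hρ0 : 0 < ρ := (norm_nonneg z).trans_lt hρ1
  have h1 := (h (ρ : ℂ) (by rwa [Complex.norm_real, Real.norm_of_nonneg hρ0.le])).tendsto_atTop_zero
  obtain ⟨C, hC⟩ := (h1.norm.bddAbove_range)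
  have hgeo : Summable fun n : ℕ => C * (‖z‖ / ρ) ^ n :=
    (summable_geometric_of_lt_one (by positivity) ((div_lt_one hρ0).2 hρ1)).mul_left C
  refine Summable.of_nonneg_of_le (fun n => by positivity) (fun n => ?_) hgeo
  have h2 : ‖((n.factorial : ℂ))⁻¹ • (ρ : ℂ) ^ n • v n‖ ≤ C := hC ⟨n, rfl⟩
  rw [norm_smul, norm_smul, norm_inv, norm_pow, Complex.norm_real, Real.norm_of_nonneg hρ0.le,
    Complex.norm_natCast] at h2
  calc ‖z ^ n • v n‖ / n.factorial
      = ((n.factorial : ℝ)⁻¹ * (ρ ^ n * ‖v n‖)) * (‖z‖ / ρ) ^ n := by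
        rw [norm_smul, norm_pow, div_pow]
        field_simp
    _ ≤ _ := by gcongr

/-- Polynomials times `exp (-x² / 2)` are analytic vectors of the generator of dilations, with
radius of convergence at least `π / 4`. -/
theorem mem_expGraph_dilGauss {θ : ℝ} (hθ : |θ| < Real.pi / 4) (P : Polynomial ℂ) :
    (toL2 (gaussS 1 P), toL2 (dilGauss (Complex.I * θ) P)) ∈
      expGraph (ofSchwartz ((Complex.I * θ) • dilS)) := by
  have hz : ‖Complex.I * (θ : ℂ)‖ < Real.pi / 4 := by simpa using hθ
  refine ⟨fun n => (Complex.I * θ) ^ n • toL2 (gaussS 1 (polyDil^[n] P)), fun n => ?_,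
    summable_norm_of_hasSum_on_ball (fun z hz => (hasSum_toL2_dilGauss P hz).summable) hz,
    hasSum_toL2_dilGauss P hz⟩
  have := mem_opPow_graph_of_chain (K := ofSchwartz ((Complex.I * θ) • dilS))
    (fun n => (Complex.I * θ) ^ n • toL2 (gaussS 1 (polyDil^[n] P))) (fun n => ?_) n
  · simpa using this
  · refine mem_ofSchwartz_graph.2 ⟨(Complex.I * θ) ^ n • gaussS 1 (polyDil^[n] P),
      by rw [map_smul], ?_⟩
    rw [map_smul, LinearMap.smul_apply, dilS_gaussS, ← Function.iterate_succ_apply' polyDil,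
      map_smul, map_smul, smul_smul, pow_succ]

/-- Real dilations are unitary. -/
theorem norm_toL2_dilGauss_add_ofReal (P : Polynomial ℂ) {ζ : ℂ} (hζ : ζ ∈ strip) (t : ℝ) :
    ‖toL2 (dilGauss (ζ + t) P)‖ = ‖toL2 (dilGauss ζ P)‖ := by
  have hζt : ζ + t ∈ strip := by
    have : |ζ.im| < Real.pi / 4 := hζ
    simpa [strip] using this
  have hw := exp_two_mul_re_pos hζ
  have hwt := exp_two_mul_re_pos hζt
  rw [← sq_eq_sq₀ (norm_nonneg _) (norm_nonneg _), norm_toL2_sq, norm_toL2_sq]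
  have h1 : ∀ x : ℝ, ‖dilGauss (ζ + t) P x‖ ^ 2 =
      Real.exp t * ‖dilGauss ζ P (Real.exp t * x)‖ ^ 2 := by
    intro x
    have h2 : dilGauss (ζ + t) P x = (Real.exp (t / 2) : ℂ) * dilGauss ζ P (Real.exp t * x) := by
      rw [dilGauss, dilGauss, smul_apply, smul_apply, gaussS_apply hwt, gaussS_apply hw,
        smul_eq_mul, smul_eq_mul, add_div, Complex.exp_add]
      simp only [Polynomial.eval_comp, Polynomial.eval_mul, Polynomial.eval_C, Polynomial.eval_X]
      have h3 : gauss (Complex.exp (2 * (ζ + t))) x =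
          gauss (Complex.exp (2 * ζ)) (Real.exp t * x) := by
        rw [gauss, gauss, mul_add, Complex.exp_add, two_mul (t : ℂ), Complex.exp_add]
        push_cast
        ring_nf
      rw [h3, Complex.exp_add]
      push_cast
      rw [mul_assoc (Complex.exp ζ)]
      ring
    rw [h2, norm_mul, mul_pow, Complex.norm_real, Real.norm_of_nonneg (Real.exp_pos _).le,
      ← Real.exp_nat_mul]
    congr 2
    push_cast
    ring
  simp only [h1]
  rw [integral_const_mul,
    Measure.integral_comp_mul_left (fun x => ‖dilGauss ζ P x‖ ^ 2) (Real.exp t),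
    abs_of_nonneg (by positivity), smul_eq_mul, mul_inv_cancel_left₀ (Real.exp_pos t).ne']

/-- The orbit under complex dilations is bounded on closed substrips: by unitarity of real dilations
only the imaginary part matters, and it ranges over a compact interval. -/
theorem exists_norm_toL2_dilGauss_le (P : Polynomial ℂ) {b : ℝ} (hb : b < Real.pi / 4) :
    ∃ C, ∀ ζ : ℂ, |ζ.im| ≤ b → ‖toL2 (dilGauss ζ P)‖ ≤ C := by
  have hcont : ContinuousOn (fun s : ℝ => ‖toL2 (dilGauss (s * Complex.I) P)‖)
      (Set.Icc (-b) b) := by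
    intro s hs
    have hs' : (s : ℂ) * Complex.I ∈ strip := by
      simpa [strip] using (abs_le.2 hs).trans_lt hb
    have h1 := (hasDerivAt_toL2_dilGauss P hs').continuousAt
    refine ContinuousAt.continuousWithinAt (ContinuousAt.norm ?_)
    exact ContinuousAt.comp (f := fun s : ℝ => (s : ℂ) * Complex.I) h1 (by fun_prop)
  obtain ⟨C, hC⟩ := isCompact_Icc.bddAbove_image hcont
  refine ⟨C, fun ζ hζ => ?_⟩
  have hs' : (ζ.im : ℂ) * Complex.I ∈ strip := by
    simpa [strip] using hζ.trans_lt hb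
  have h := norm_toL2_dilGauss_add_ofReal P hs' ζ.re
  rw [add_comm, Complex.re_add_im] at h
  rw [h]
  exact hC ⟨ζ.im, abs_le.1 hζ, rfl⟩

/-- The dilation by `e^{iθ}` takes the Hermite functions to those of complex scale `e^{iθ}`. -/
theorem dilGauss_hermP (θ : ℝ) (n : ℕ) : dilGauss (Complex.I * θ) (hermP 0 n) =
    Complex.exp (Complex.I * θ / 2) • gaussS (Complex.exp (2 * Complex.I * θ)) (hermP θ n) := by
  rw [dilGauss, hermP, hermP, Polynomial.comp_assoc, mul_assoc]
  simp

end Swanson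

namespace Swanson

/-! ### Self-adjointness of the metric operator -/

section Liouville

variable {h : ℂ → ℂ} {b θ : ℝ} {μ : ℂ}

/-- The relation under translation by `iθ`, iterated within the strip: the local pieces from which
`eq_zero_of_quasiperiodic` glues an entire function agree where they overlap. -/
theorem quasiperiodic_int (hθ0 : 0 < θ) (hμ : μ ≠ 0)
    (hper : ∀ ζ : ℂ, |ζ.im| < b → |ζ.im + θ| < b → h (ζ + θ * Complex.I) = μ * h ζ)
    {ζ : ℂ} (k m : ℤ) (hk : |ζ.im - k * θ| < b) (hm : |ζ.im - m * θ| < b) :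
    μ ^ k * h (ζ - (k * θ : ℝ) * Complex.I) = μ ^ m * h (ζ - (m * θ : ℝ) * Complex.I) := by
  have hnat : ∀ (n : ℕ) (z : ℂ), |z.im| < b → |z.im + n * θ| < b →
      h (z + (n * θ : ℝ) * Complex.I) = μ ^ n * h z := by
    intro n
    induction n with
    | zero => intro z _ _; simp
    | succ n ih =>
      intro z hz hzn
      push_cast at hzn
      have h0 : (0 : ℝ) ≤ n * θ := by positivity
      rw [abs_lt] at hz hzn
      have h1 : |z.im + n * θ| < b := abs_lt.2 ⟨by linarith, by nlinarith⟩
      have h2 := hper (z + (n * θ : ℝ) * Complex.I) (by simpa using h1)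
        (by simpa [abs_lt] using ⟨by nlinarith, by nlinarith⟩)
      rw [ih z (abs_lt.2 hz) h1] at h2
      rw [pow_succ', mul_assoc, ← h2]
      congr 1
      push_cast
      ring
  wlog hkm : k ≤ m generalizing k m
  · exact (this m k hm hk (le_of_not_ge hkm)).symm
  obtain ⟨n, rfl⟩ := Int.le.dest hkm
  have h1 := hnat n (ζ - ((k + n : ℤ) * θ : ℝ) * Complex.I) (by simpa using hm) (by
    simp only [Complex.sub_im, Complex.mul_im, Complex.ofReal_re, Complex.I_im, mul_one,
      Complex.ofReal_im, Complex.I_re, mul_zero, add_zero]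
    convert hk using 2
    push_cast
    ring)
  rw [zpow_add₀ hμ, mul_assoc, zpow_natCast, ← h1]
  congr 2
  push_cast
  ring

/-- A function which is holomorphic on a strip, bounded on a narrower closed strip, and multiplied
by a phase `μ ≠ 1` under a translation by `iθ` extends to a bounded entire function, which is
constant by Liouville's theorem and hence zero. -/
theorem eq_zero_of_quasiperiodic (hθ0 : 0 < θ) (hθb : θ < b) (hμ : ‖μ‖ = 1) (hμ1 : μ ≠ 1)
    (hd : ∀ ζ : ℂ, |ζ.im| < b → DifferentiableAt ℂ h ζ)
    (hC : ∃ C, ∀ ζ : ℂ, |ζ.im| ≤ θ → ‖h ζ‖ ≤ C)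
    (hper : ∀ ζ : ℂ, |ζ.im| < b → |ζ.im + θ| < b → h (ζ + θ * Complex.I) = μ * h ζ) :
    h 0 = 0 := by
  have hμ0 : μ ≠ 0 := by
    rintro rfl
    simp at hμ
  obtain ⟨C, hC⟩ := hC
  -- translate `ζ` by the multiple of `iθ` which brings it closest to the real axis
  let k : ℂ → ℤ := fun ζ => round (ζ.im / θ)
  let H : ℂ → ℂ := fun ζ => μ ^ k ζ * h (ζ - (k ζ * θ : ℝ) * Complex.I)
  have hk : ∀ ζ : ℂ, |ζ.im - k ζ * θ| ≤ θ := by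
    intro ζ
    have h1 := abs_sub_round (ζ.im / θ)
    have h2 : ζ.im - k ζ * θ = (ζ.im / θ - round (ζ.im / θ)) * θ := by
      simp only [k]
      field_simp
    rw [h2, abs_mul, abs_of_pos hθ0]
    nlinarith
  have hHd : Differentiable ℂ H := by
    intro ζ
    have hopen : IsOpen {z : ℂ | |z.im - k ζ * θ| < b} := isOpen_lt (by fun_prop) continuous_const
    have hev : H =ᶠ[nhds ζ] fun z => μ ^ k ζ * h (z - (k ζ * θ : ℝ) * Complex.I) := by
      filter_upwards [hopen.mem_nhds ((hk ζ).trans_lt hθb)] with z hz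
      exact quasiperiodic_int hθ0 hμ0 hper _ _ ((hk z).trans_lt hθb) hz
    rw [hev.differentiableAt_iff]
    have h1 : DifferentiableAt ℂ h (ζ - (k ζ * θ : ℝ) * Complex.I) := by
      refine hd _ ?_
      simpa using (hk ζ).trans_lt hθb
    refine DifferentiableAt.const_mul ?_ _
    exact DifferentiableAt.comp (f := fun z : ℂ => z - (k ζ * θ : ℝ) * Complex.I) ζ h1
      (by fun_prop)
  have hHb : Bornology.IsBounded (Set.range H) := by
    rw [isBounded_iff_forall_norm_le]
    refine ⟨C, ?_⟩
    rintro _ ⟨ζ, rfl⟩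
    rw [norm_mul, norm_zpow, hμ, one_zpow, one_mul]
    refine hC _ ?_
    simpa using hk ζ
  have h1 := hHd.apply_eq_apply_of_bounded hHb (θ * Complex.I) 0
  have hk0 : k 0 = 0 := by simp [k]
  have hk1 : k (θ * Complex.I) = 1 := by simp [k, hθ0.ne']
  simp only [H, hk0, hk1] at h1
  simp only [zpow_one, Int.cast_one, one_mul, sub_self, zpow_zero, Int.cast_zero, zero_mul,
    Complex.ofReal_zero] at h1
  have h2 : (μ - 1) * h 0 = 0 := by linear_combination h1
  exact (mul_eq_zero.1 h2).resolve_left (sub_ne_zero.2 hμ1)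

end Liouville

theorem convex_strip : Convex ℝ strip := by
  have : strip = (fun z : ℂ => z.im) ⁻¹' Set.Ioo (-(Real.pi / 4)) (Real.pi / 4) := by
    ext z
    simp [strip, abs_lt]
  rw [this]
  exact (convex_Ioo _ _).is_linear_preimage ⟨Complex.add_im, fun c z => by simp⟩

section Core

variable {θ : ℝ}

/-- If the holomorphic orbit relation `⟪g, f_{ζ + iθ}⟫ + σ ⟪g, f_ζ⟫ = 0` holds at `ζ = 0` for all
`f = P(x) exp (-x² / 2)`, then it also holds for all derivatives in `ζ` at `ζ = 0`, hence
identically. -/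
theorem inner_dilGauss_add_eq_zero (hθ : |θ| < Real.pi / 4) {σ : ℂ} {g : L2}
    (hg : ∀ P, inner ℂ g (toL2 (dilGauss (Complex.I * θ) P))
      + σ * inner ℂ g (toL2 (dilGauss 0 P)) = 0) (P : Polynomial ℂ) {ζ : ℂ} (hζ : ζ ∈ strip)
    (hζ' : ζ + Complex.I * θ ∈ strip) :
    inner ℂ g (toL2 (dilGauss (ζ + Complex.I * θ) P)) +
      σ * inner ℂ g (toL2 (dilGauss ζ P)) = 0 := by
  set D : Polynomial ℂ → ℂ → ℂ := fun P ζ =>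
    inner ℂ g (toL2 (dilGauss (ζ + Complex.I * θ) P)) + σ * inner ℂ g (toL2 (dilGauss ζ P)) with hD
  set U : Set ℂ := strip ∩ (fun ζ => ζ + Complex.I * θ) ⁻¹' strip with hU
  have hUo : IsOpen U := isOpen_strip.inter (isOpen_strip.preimage (by fun_prop))
  have hUc : IsPreconnected U := by
    refine (convex_strip.inter ?_).isPreconnected
    have := convex_strip.translate_preimage_left (Complex.I * θ)
    exact this
  have h0 : (0 : ℂ) ∈ U := by
    refine ⟨ball_subset_strip (Metric.mem_ball_self (by positivity)), ?_⟩
    simpa [strip] using hθ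
  have hder : ∀ P, ∀ ζ ∈ U, HasDerivAt (D P) (D (polyDil P) ζ) ζ := by
    intro P ζ hζ
    have h1 := (innerSL ℂ g).hasFDerivAt.comp_hasDerivAt ζ
      ((hasDerivAt_toL2_dilGauss P hζ.2).comp_add_const ζ (Complex.I * θ))
    have h2 := (innerSL ℂ g).hasFDerivAt.comp_hasDerivAt ζ (hasDerivAt_toL2_dilGauss P hζ.1)
    exact h1.add (h2.const_mul σ)
  have hiter : ∀ (k : ℕ) (ζ : ℂ), ζ ∈ U → iteratedDeriv k (D P) ζ = D (polyDil^[k] P) ζ := by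
    intro k
    induction k with
    | zero => intro ζ _; rfl
    | succ k ih =>
      intro ζ hζ
      rw [iteratedDeriv_succ, Function.iterate_succ_apply',
        ← (hder (polyDil^[k] P) ζ hζ).deriv]
      refine Filter.EventuallyEq.deriv_eq ?_
      filter_upwards [hUo.mem_nhds hζ] with z hz
      exact ih z hz
  have hdiff : DifferentiableOn ℂ (D P) U := fun ζ hζ =>
    (hder P ζ hζ).differentiableAt.differentiableWithinAt
  obtain ⟨r, hr, hrU⟩ := Metric.isOpen_iff.1 hUo 0 h0
  have hev : D P =ᶠ[nhds 0] 0 := by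
    filter_upwards [Metric.ball_mem_nhds (0 : ℂ) hr] with z hz
    have h1 := Complex.hasSum_taylorSeries_on_ball (hdiff.mono hrU) hz
    have h2 : ∀ k, iteratedDeriv k (D P) 0 = 0 := by
      intro k
      rw [hiter k 0 h0, hD]
      simpa using hg (polyDil^[k] P)
    simp only [h2, smul_zero] at h1
    exact h1.unique hasSum_zero
  exact (hdiff.analyticOnNhd hUo).eqOn_zero_of_preconnected_of_eventuallyEq_zero hUc h0 hev
    ⟨hζ, hζ'⟩

/-- The ranges of `T_θ ± i`, restricted to polynomials times `exp (-x² / 2)`, are dense. -/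
theorem eq_zero_of_inner_dilGauss_add (hθ : |θ| < Real.pi / 4) (hθ0 : θ ≠ 0) {σ : ℂ}
    (hσ : σ = Complex.I ∨ σ = -Complex.I) {g : L2}
    (hg : ∀ P, inner ℂ (toL2 (dilGauss (Complex.I * θ) P) + σ • toL2 (gaussS 1 P)) g = 0) :
    g = 0 := by
  have hg' : ∀ P, inner ℂ g (toL2 (dilGauss (Complex.I * θ) P))
      + σ * inner ℂ g (toL2 (dilGauss 0 P)) = 0 := by
    intro P
    have := congrArg (starRingEnd ℂ) (hg P)
    rwa [inner_conj_symm, inner_add_right, inner_smul_right, map_zero, ← dilGauss_zero] at this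
  have hσn : ‖-σ‖ = 1 := by rcases hσ with rfl | rfl <;> simp
  have hσ1 : -σ ≠ 1 := by
    rcases hσ with rfl | rfl <;> intro h <;> simpa using congrArg Complex.re h
  have hσ0 : -σ ≠ 0 := by
    intro h
    rw [h] at hσn
    simp at hσn
  refine eq_zero_of_inner_gaussS (w := 1) (by simp) fun P => ?_
  rw [← dilGauss_zero, ← inner_conj_symm, map_eq_zero]
  have hd : ∀ ζ : ℂ, |ζ.im| < Real.pi / 4 →
      DifferentiableAt ℂ (fun ζ => inner ℂ g (toL2 (dilGauss ζ P))) ζ := fun ζ hζ =>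
    ((innerSL ℂ g).hasFDerivAt.comp_hasDerivAt ζ
      (hasDerivAt_toL2_dilGauss P hζ)).differentiableAt
  have hC : ∃ C, ∀ ζ : ℂ, |ζ.im| ≤ |θ| → ‖inner ℂ g (toL2 (dilGauss ζ P))‖ ≤ C := by
    obtain ⟨C, hC⟩ := exists_norm_toL2_dilGauss_le P hθ
    refine ⟨‖g‖ * C, fun ζ hζ => (norm_inner_le_norm _ _).trans ?_⟩
    gcongr
    exact hC ζ hζ
  have hrel : ∀ ζ : ℂ, |ζ.im| < Real.pi / 4 → |ζ.im + θ| < Real.pi / 4 →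
      inner ℂ g (toL2 (dilGauss (ζ + θ * Complex.I) P)) =
        -σ * inner ℂ g (toL2 (dilGauss ζ P)) := by
    intro ζ hζ hζ'
    have := inner_dilGauss_add_eq_zero hθ hg' P (ζ := ζ) hζ (by simpa [strip] using hζ')
    rw [mul_comm Complex.I] at this
    linear_combination this
  -- for negative `θ` the inverse translation is used, with the inverse phase
  rcases lt_or_gt_of_ne hθ0 with h | h
  · rw [abs_of_neg h] at hθ hC
    refine eq_zero_of_quasiperiodic (h := fun ζ => inner ℂ g (toL2 (dilGauss ζ P)))
      (neg_pos.2 h) hθ (μ := (-σ)⁻¹) (by rw [norm_inv, hσn, inv_one])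
      (by rwa [Ne, inv_eq_one]) hd hC fun ζ hζ hζ' => ?_
    have h1 := hrel (ζ + (-θ : ℝ) * Complex.I) (by simpa using hζ') (by simpa using hζ)
    rw [eq_inv_mul_iff_mul_eq₀ hσ0, ← h1]
    congr 3
    push_cast
    ring
  · rw [abs_of_pos h] at hθ hC
    exact eq_zero_of_quasiperiodic (h := fun ζ => inner ℂ g (toL2 (dilGauss ζ P)))
      h hθ hσn hσ1 hd hC hrel

theorem opT_eq (θ : ℝ) : opT θ = opExp (ofSchwartz ((Complex.I * θ) • dilS)) := by
  rw [opT, opT_generator_eq]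

/-- `T_θ` acts on polynomials times `exp (-x² / 2)` as the dilation by `e^{iθ}`. -/
theorem mem_opT_graph_dilGauss (hθ : |θ| < Real.pi / 4) (P : Polynomial ℂ) :
    (toL2 (gaussS 1 P), toL2 (dilGauss (Complex.I * θ) P)) ∈ (opT θ).graph := by
  rw [opT_eq]
  exact mem_opExp_graph_of_mem_expGraph (mem_expGraph_dilGauss hθ P)

theorem expGraph_domain_dense (hθ : |θ| < Real.pi / 4) :
    Dense ((expGraph (ofSchwartz ((Complex.I * θ) • dilS))).toLinearPMap.domain : Set L2) := by
  rw [Submodule.dense_iff_topologicalClosure_eq_top,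
    Submodule.topologicalClosure_eq_top_iff, Submodule.eq_bot_iff]
  intro g hg
  refine eq_zero_of_inner_gaussS (w := 1) (by simp) fun P => ?_
  refine (Submodule.mem_orthogonal _ _).1 hg _ (LinearPMap.mem_domain_of_mem_graph
    (y := toL2 (dilGauss (Complex.I * θ) P)) ?_)
  rw [expGraph_toLinearPMap_graph]
  exact mem_expGraph_dilGauss hθ P

theorem opT_isClosed (hθ : |θ| < Real.pi / 4) : (opT θ).IsClosed := by
  rw [opT_eq]
  exact opExp_isClosed (opT_generator_isFormalAdjoint θ) (expGraph_domain_dense hθ)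

theorem opT_isFormalAdjoint (hθ : |θ| < Real.pi / 4) : (opT θ).IsFormalAdjoint (opT θ) := by
  rw [opT_eq]
  exact opExp_isFormalAdjoint (opT_generator_isFormalAdjoint θ) (expGraph_domain_dense hθ)

theorem opT_domain_dense (hθ : |θ| < Real.pi / 4) : Dense ((opT θ).domain : Set L2) := by
  rw [opT_eq]
  exact (expGraph_domain_dense hθ).mono (LinearPMap.le_closure _).1

theorem opT_isSelfAdjoint (hθ : |θ| < Real.pi / 4) (hθ0 : θ ≠ 0) : IsSelfAdjoint (opT θ) :=
  isSelfAdjoint_of_core (opT_isClosed hθ) (opT_domain_dense hθ) (opT_isFormalAdjoint hθ)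
    (mem_opT_graph_dilGauss hθ) fun _ hσ _ hg => eq_zero_of_inner_dilGauss_add hθ hθ0 hσ hg

end Core

end Swanson

namespace Swanson

/-! ### Biorthogonality and eigenvectors -/

theorem raiseS_lowerS_phiS {θ : ℝ} (hθ : 0 < Real.cos (2 * θ)) (N : ℂ) (n : ℕ) :
    raiseS θ (lowerS θ (phiS θ N n)) = (n : ℂ) • phiS θ N n := by
  cases n with
  | zero => rw [lowerS_phiS_zero hθ, map_zero, Nat.cast_zero, zero_smul]
  | succ n =>
    rw [lowerS_phiS_succ hθ, map_smul, raiseS_phiS hθ, smul_smul, sqrt_succ_mul_self]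
    push_cast
    rfl

/-- Biorthogonality: `B_θ A_θ` has eigenvalue `n` on `φₙ`, its formal adjoint has eigenvalue `m` on
`Ψₘ`, and the diagonal terms are all equal by the ladder relations. -/
theorem inner_phiS_phiS_neg {θ : ℝ} (hθ : 0 < Real.cos (2 * θ)) (hθ' : 0 < Real.cos θ)
    {N₁ N₂ : ℂ} (hN : (starRingEnd ℂ) N₁ * N₂ = Complex.exp (-(Complex.I * θ)) / Real.sqrt Real.pi)
    (n m : ℕ) :
    inner ℂ (toL2 (phiS θ N₁ n)) (toL2 (phiS (-θ) N₂ m)) = if n = m then (1 : ℂ) else 0 := by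
  have hθn : 0 < Real.cos (2 * -θ) := by rwa [mul_neg, Real.cos_neg]
  split_ifs with hnm
  · subst hnm
    induction n with
    | zero =>
      rw [inner_phiS_zero hθ hθ', hN]
      have h1 : (Real.sqrt Real.pi : ℂ) ≠ 0 :=
        Complex.ofReal_ne_zero.2 (Real.sqrt_pos.2 Real.pi_pos).ne'
      have h2 := exp_I_mul_mul_exp_neg θ
      field_simp
      linear_combination h2
    | succ n ih =>
      have h := inner_raiseS θ (phiS θ N₁ n) (phiS (-θ) N₂ (n + 1))
      rw [raiseS_phiS hθ, lowerS_phiS_succ hθn, map_smul, map_smul, inner_smul_left,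
        inner_smul_right, ih, Complex.conj_ofReal] at h
      exact mul_left_cancel₀ (sqrt_succ_ne_zero n) h
  · have h := inner_raiseS θ (lowerS θ (phiS θ N₁ n)) (phiS (-θ) N₂ m)
    rw [inner_lowerS, raiseS_lowerS_phiS hθ, raiseS_lowerS_phiS hθn, map_smul, map_smul,
      inner_smul_left, inner_smul_right, Complex.conj_natCast] at h
    have h' : ((n : ℂ) - m) * inner ℂ (toL2 (phiS θ N₁ n)) (toL2 (phiS (-θ) N₂ m)) = 0 := by
      linear_combination h
    refine (mul_eq_zero.1 h').resolve_left (sub_ne_zero.2 ?_)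
    exact_mod_cast hnm

theorem inner_hamS (θ : ℝ) (f g : 𝓢(ℝ, ℂ)) :
    inner ℂ (toL2 (hamS θ f)) (toL2 g) = inner ℂ (toL2 f) (toL2 (hamS (-θ) g)) := by
  simp only [hamS, LinearMap.smul_apply, LinearMap.add_apply, LinearMap.comp_apply,
    LinearMap.id_apply, map_smul, map_add, inner_smul_left, inner_add_left, inner_smul_right,
    inner_add_right, inner_raiseS, inner_lowerS, map_inv₀, Complex.conj_ofReal, mul_neg,
    Real.cos_neg, one_div, Complex.conj_ofNat]

theorem hamS_phiS {θ : ℝ} (hθ : 0 < Real.cos (2 * θ)) (N : ℂ) (n : ℕ) :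
    hamS θ (phiS θ N n) = (((n : ℂ) + 1 / 2) / (Real.cos (2 * θ) : ℂ)) • phiS θ N n := by
  simp only [hamS, LinearMap.smul_apply, LinearMap.add_apply, LinearMap.comp_apply,
    LinearMap.id_apply, raiseS_lowerS_phiS hθ]
  module

/-- If an operator has eigenvectors `φ n` with eigenvalues `ev n`, and its adjoint has eigenvectors
`ψ n` which are total and biorthogonal to the `φ n`, then it has no other eigenvectors. -/
theorem mem_graph_smul_iff_of_biorthogonal {E : Type*} [NormedAddCommGroup E]
    [InnerProductSpace ℂ E] {T : E →ₗ.[ℂ] E} {φ ψ : ℕ → E} {ev : ℕ → ℂ}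
    (hφ : ∀ n, (φ n, ev n • φ n) ∈ T.graph)
    (hψ : ∀ n f h, (f, h) ∈ T.graph → inner ℂ (ψ n) h = ev n * inner ℂ (ψ n) f)
    (hbi : ∀ n m, inner ℂ (ψ n) (φ m) = if n = m then (1 : ℂ) else 0)
    (hev : Function.Injective ev) (htot : ∀ g, (∀ n, inner ℂ (ψ n) g = 0) → g = 0)
    (μ : ℂ) {f : E} (hf : f ≠ 0) :
    (f, μ • f) ∈ T.graph ↔ ∃ (n : ℕ) (c : ℂ), μ = ev n ∧ f = c • φ n := by
  constructor
  · intro h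
    have h1 : ∀ n, (μ - ev n) * inner ℂ (ψ n) f = 0 := by
      intro n
      have := hψ n _ _ h
      rw [inner_smul_right] at this
      linear_combination this
    obtain ⟨n, hn⟩ : ∃ n, inner ℂ (ψ n) f ≠ 0 := by
      by_contra! hcon
      exact hf (htot f hcon)
    have hμ : μ = ev n := sub_eq_zero.1 ((mul_eq_zero.1 (h1 n)).resolve_right hn)
    refine ⟨n, inner ℂ (ψ n) f, hμ, ?_⟩
    refine sub_eq_zero.1 (htot _ fun m => ?_)
    rw [inner_sub_right, inner_smul_right, hbi]
    split_ifs with hmn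
    · rw [hmn, mul_one, sub_self]
    · rw [mul_zero, sub_zero]
      refine (mul_eq_zero.1 (h1 m)).resolve_left ?_
      rw [hμ]
      exact sub_ne_zero.2 fun h => hmn (hev h).symm
  · rintro ⟨n, c, rfl, rfl⟩
    rw [smul_comm]
    exact T.graph.smul_mem c (hφ n)

/-! ### Growth of the norms -/

/-- `A_{-θ}`, the formal adjoint of `B_θ`, in terms of `A_θ` and `B_θ`. This turns the ladder
relations into recursions for the inner products of the `φₙ` with each other. -/
theorem lowerS_neg (θ : ℝ) : lowerS (-θ) =
    (Real.cos (2 * θ) : ℂ) • lowerS θ - (Complex.I * Real.sin (2 * θ)) • raiseS θ := by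
  have h1 : Complex.exp (-(Complex.I * (2 * θ : ℝ))) =
      Complex.exp (-(Complex.I * θ)) * Complex.exp (-(Complex.I * θ)) := by
    rw [← Complex.exp_add]; congr 1; push_cast; ring
  have h2 : Complex.exp (Complex.I * (2 * θ : ℝ)) =
      Complex.exp (Complex.I * θ) * Complex.exp (Complex.I * θ) := by
    rw [← Complex.exp_add]; congr 1; push_cast; ring
  rw [exp_neg_I_mul] at h1
  rw [exp_I_mul] at h2
  have h := exp_I_mul_mul_exp_neg θ
  rw [sub_eq_add_neg, ← neg_smul, lowerS, lowerS, raiseS, smul_ladder, smul_ladder, ladder_add]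
  congr 1
  · rw [Complex.ofReal_neg, mul_neg]
    linear_combination -Complex.exp (Complex.I * θ) * h1 - Complex.exp (-(Complex.I * θ)) * h
  · rw [Complex.ofReal_neg, mul_neg, neg_neg]
    linear_combination -Complex.exp (-(Complex.I * θ)) * h2 - Complex.exp (Complex.I * θ) * h

section Growth

variable {θ : ℝ} (hθ : 0 < Real.cos (2 * θ)) (N : ℂ)

include hθ

theorem inner_phiS_recurrence (n : ℕ) :
    (Real.sqrt (n + 1) : ℂ) * ‖toL2 (phiS θ N (n + 1))‖ ^ 2 =
      Real.cos (2 * θ) * Real.sqrt (n + 1) * ‖toL2 (phiS θ N n)‖ ^ 2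
        - Complex.I * Real.sin (2 * θ) * Real.sqrt (n + 1 + 1) *
          inner ℂ (toL2 (phiS θ N n)) (toL2 (phiS θ N (n + 2))) := by
  have h := inner_raiseS θ (phiS θ N n) (phiS θ N (n + 1))
  simp only [lowerS_neg, LinearMap.sub_apply, LinearMap.smul_apply, raiseS_phiS hθ,
    lowerS_phiS_succ hθ, map_sub, map_smul, inner_smul_left, inner_sub_right, inner_smul_right,
    Complex.conj_ofReal, inner_self_eq_norm_sq_to_K] at h
  simp only [Nat.cast_add, Nat.cast_one, RCLike.ofReal_eq_complex_ofReal] at h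
  linear_combination h

theorem inner_phiS_recurrence_two (n : ℕ) :
    (Real.sqrt (n + 2 + 1) : ℂ) * inner ℂ (toL2 (phiS θ N (n + 1))) (toL2 (phiS θ N (n + 3))) =
      Real.cos (2 * θ) * Real.sqrt (n + 1) *
        inner ℂ (toL2 (phiS θ N n)) (toL2 (phiS θ N (n + 2)))
      + Complex.I * Real.sin (2 * θ) * Real.sqrt (n + 1 + 1) * ‖toL2 (phiS θ N (n + 2))‖ ^ 2 := by
  have h := inner_lowerS (-θ) (phiS θ N (n + 1)) (phiS θ N (n + 2))
  simp only [lowerS_neg, neg_neg, LinearMap.sub_apply, LinearMap.smul_apply, raiseS_phiS hθ,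
    lowerS_phiS_succ hθ, map_sub, map_smul, inner_smul_left, inner_sub_left, inner_smul_right,
    Complex.conj_ofReal, inner_self_eq_norm_sq_to_K, map_mul, Complex.conj_I] at h
  simp only [Nat.cast_add, Nat.cast_one, Nat.cast_ofNat, RCLike.ofReal_eq_complex_ofReal] at h
  linear_combination -h

theorem inner_phiS_recurrence_zero :
    (Real.sqrt 2 : ℂ) * inner ℂ (toL2 (phiS θ N 0)) (toL2 (phiS θ N 2)) =
      Complex.I * Real.sin (2 * θ) * ‖toL2 (phiS θ N 1)‖ ^ 2 := by
  have h := inner_lowerS (-θ) (phiS θ N 0) (phiS θ N 1)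
  simp only [lowerS_neg, neg_neg, LinearMap.sub_apply, LinearMap.smul_apply, raiseS_phiS hθ,
    lowerS_phiS_zero hθ, map_sub, map_smul, inner_smul_left, inner_sub_left, inner_smul_right,
    Complex.conj_ofReal, inner_self_eq_norm_sq_to_K, map_mul, Complex.conj_I, smul_zero,
    map_zero, inner_zero_left] at h
  simp only [Nat.cast_zero, Nat.cast_one, zero_add, Real.sqrt_one, Complex.ofReal_one,
    one_add_one_eq_two, RCLike.ofReal_eq_complex_ofReal] at h
  linear_combination -h

/-- The squared norms satisfy the recursion of the Legendre polynomials at `1 / cos 2θ`. -/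
theorem norm_phiS_sq_recurrence (n : ℕ) :
    Real.cos (2 * θ) ^ 2 * ((n + 2) * ‖toL2 (phiS θ N (n + 2))‖ ^ 2) =
      Real.cos (2 * θ) * ((2 * n + 3) * ‖toL2 (phiS θ N (n + 1))‖ ^ 2)
        - Real.cos (2 * θ) ^ 2 * ((n + 1) * ‖toL2 (phiS θ N n)‖ ^ 2) := by
  have h0 := inner_phiS_recurrence hθ N n
  have h1 := inner_phiS_recurrence hθ N (n + 1)
  have h2 := inner_phiS_recurrence_two hθ N n
  have hr1 := sqrt_succ_mul_self n
  have hr2 := sqrt_succ_mul_self (n + 1)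
  have hcs : (Real.sin (2 * θ) : ℂ) ^ 2 + (Real.cos (2 * θ) : ℂ) ^ 2 = 1 := by
    exact_mod_cast Real.sin_sq_add_cos_sq (2 * θ)
  have hI := Complex.I_mul_I
  simp only [Nat.cast_add, Nat.cast_one] at h1 hr2
  rw [show (n : ℝ) + 1 + 1 + 1 = n + 2 + 1 by ring] at h1
  rw [← Complex.ofReal_inj]
  simp only [Complex.ofReal_mul, Complex.ofReal_sub, Complex.ofReal_add, Complex.ofReal_pow,
    Complex.ofReal_natCast, Complex.ofReal_one, Complex.ofReal_ofNat]
  generalize (‖toL2 (phiS θ N (n + 2))‖ : ℂ) = A2 at *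
  generalize (‖toL2 (phiS θ N (n + 1))‖ : ℂ) = A1 at *
  generalize (‖toL2 (phiS θ N n)‖ : ℂ) = A0 at *
  generalize (Real.cos (2 * θ) : ℂ) = c at *
  generalize (Real.sin (2 * θ) : ℂ) = s at *
  generalize (Real.sqrt (n + 1) : ℂ) = r1 at *
  generalize (Real.sqrt (n + 1 + 1) : ℂ) = r2 at *
  linear_combination r2 * h1 - Complex.I * s * r2 * h2 - c * r1 * h0
    - (A2 ^ 2 * (1 + Complex.I ^ 2 * s ^ 2) - c * A1 ^ 2) * hr2
    - (-c * A1 ^ 2 + c ^ 2 * A0 ^ 2) * hr1 + (n + 2) * A2 ^ 2 * hcs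
    - (n + 2) * A2 ^ 2 * s ^ 2 * hI

theorem norm_phiS_sq_recurrence_zero :
    Real.cos (2 * θ) ^ 2 * ‖toL2 (phiS θ N 1)‖ ^ 2 =
      Real.cos (2 * θ) * ‖toL2 (phiS θ N 0)‖ ^ 2 := by
  have h0 := inner_phiS_recurrence hθ N 0
  have h1 := inner_phiS_recurrence_zero hθ N
  have hcs : (Real.sin (2 * θ) : ℂ) ^ 2 + (Real.cos (2 * θ) : ℂ) ^ 2 = 1 := by
    exact_mod_cast Real.sin_sq_add_cos_sq (2 * θ)
  have hI := Complex.I_mul_I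
  rw [← Complex.ofReal_inj]
  simp only [Nat.cast_zero, zero_add, Real.sqrt_one, Complex.ofReal_one, one_mul, mul_one,
    one_add_one_eq_two] at h0
  simp only [Complex.ofReal_mul, Complex.ofReal_pow]
  linear_combination h0 - Complex.I * Real.sin (2 * θ) * h1
    + (‖toL2 (phiS θ N 1)‖ : ℂ) ^ 2 * hcs
    - (‖toL2 (phiS θ N 1)‖ : ℂ) ^ 2 * (Real.sin (2 * θ) : ℂ) ^ 2 * hI

end Growth

/-- A sequence satisfying the recursion of the Legendre polynomials at a point `1 / c > 1` is
unbounded. -/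
theorem exists_lt_of_legendre_recurrence {a : ℕ → ℝ} {c : ℝ} (hc0 : 0 < c) (hc1 : c < 1)
    (ha : 0 < a 0) (h0 : c ^ 2 * a 1 = c * a 0)
    (hrec : ∀ n : ℕ, c ^ 2 * ((n + 2) * a (n + 2)) =
      c * ((2 * n + 3) * a (n + 1)) - c ^ 2 * ((n + 1) * a n)) (C : ℝ) : ∃ n, C < a n := by
  -- by induction, all increments of the sequence are at least `δ`
  set δ := (1 / c - 1) * a 0 with hδ
  have hx : 0 < 1 / c - 1 := by
    rw [sub_pos, lt_div_iff₀ hc0]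
    linarith
  have hδ0 : 0 < δ := mul_pos hx ha
  have key : ∀ n : ℕ, a 0 ≤ a n ∧ δ ≤ a (n + 1) - a n := by
    intro n
    induction n with
    | zero =>
      refine ⟨le_rfl, le_of_eq ?_⟩
      rw [hδ, zero_add]
      field_simp
      nlinarith [mul_pos hc0 hc0, mul_left_cancel₀ hc0.ne' (show c * (c * a 1) = c * a 0 by
        rw [← h0]; ring)]
    | succ n ih =>
      refine ⟨by linarith, ?_⟩
      have h1 : (n + 2) * (a (n + 2) - a (n + 1)) =
          (2 * n + 3) * ((1 / c - 1) * a (n + 1)) + (n + 1) * (a (n + 1) - a n) := by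
        have h2 := hrec n
        field_simp
        refine mul_left_cancel₀ hc0.ne' ?_
        linear_combination h2
      have h3 : δ ≤ (1 / c - 1) * a (n + 1) := by
        rw [hδ]
        gcongr
        linarith
      have hn : (0 : ℝ) ≤ n := n.cast_nonneg
      have h4 : (n + 2) * δ ≤ (n + 2) * (a (n + 2) - a (n + 1)) := by
        rw [h1]
        nlinarith [mul_le_mul_of_nonneg_left h3 (show (0 : ℝ) ≤ 2 * n + 3 by positivity),
          mul_le_mul_of_nonneg_left ih.2 (show (0 : ℝ) ≤ n + 1 by positivity),
          mul_nonneg hn hδ0.le]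
      exact le_of_mul_le_mul_left h4 (by positivity)
  have hlin : ∀ n : ℕ, n * δ ≤ a n := by
    intro n
    induction n with
    | zero => simpa using ha.le
    | succ n ih =>
      push_cast
      linarith [(key n).2]
  obtain ⟨n, hn⟩ := exists_nat_gt (C / δ)
  exact ⟨n, ((div_lt_iff₀ hδ0).1 hn).trans_le (hlin n)⟩

end Swanson

namespace Swanson

/-! ### Consequences for bases, unboundedness and similarity -/

theorem exists_lt_norm_of_sq {E : Type*} [NormedAddCommGroup E] {f : ℕ → E}
    (h : ∀ C : ℝ, ∃ n, C < ‖f n‖ ^ 2) (C : ℝ) : ∃ n, C < ‖f n‖ := by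
  obtain ⟨n, hn⟩ := h (max C 1 ^ 2)
  exact ⟨n, (le_max_left _ _).trans_lt (lt_of_pow_lt_pow_left₀ 2 (norm_nonneg _) hn)⟩

section Abstract

variable {E : Type*} [NormedAddCommGroup E] [InnerProductSpace ℂ E]

theorem not_isRieszBasis_of_norm_unbounded {f : ℕ → E} (hf : ∀ C : ℝ, ∃ n, C < ‖f n‖) :
    ¬ IsRieszBasis f := by
  rintro ⟨e, V, hV⟩
  obtain ⟨n, hn⟩ := hf ‖(V : E →L[ℂ] E)‖
  refine hn.not_ge ?_
  rw [hV n]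
  have h := (V : E →L[ℂ] E).le_opNorm (e n)
  rwa [e.orthonormal.1 n, mul_one] at h

theorem not_isBoundedOp_of_norm_unbounded {T : E →ₗ.[ℂ] E} {u v : ℕ → E}
    (huv : ∀ n, (u n, v n) ∈ T.graph) (hu : ∀ n, ‖u n‖ = 1) (hv : ∀ C : ℝ, ∃ n, C < ‖v n‖) :
    ¬ IsBoundedOp T := by
  rintro ⟨C, hC⟩
  obtain ⟨n, hn⟩ := hv C
  refine hn.not_ge ?_
  obtain ⟨x, hx, hxv⟩ := (LinearPMap.mem_graph_iff _).1 (huv n)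
  have h := hC x
  dsimp only at hx hxv
  rwa [hx, hxv, hu, mul_one] at h

theorem exists_lt_norm_smul {f : ℕ → E} (h : ∀ C : ℝ, ∃ n, C < ‖f n‖) {c : ℂ} (hc : c ≠ 0) (C : ℝ) :
    ∃ n, C < ‖c • f n‖ := by
  obtain ⟨n, hn⟩ := h (C / ‖c‖)
  refine ⟨n, ?_⟩
  rw [norm_smul]
  rwa [div_lt_iff₀' (norm_pos_iff.2 hc)] at hn

/-- Two operators which are defined and agree on a set agree on its linear span. -/
theorem domRestrict_span_le {S T : E →ₗ.[ℂ] E} {s : Set E}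
    (h : ∀ x ∈ s, ∃ y, (x, y) ∈ S.graph ∧ (x, y) ∈ T.graph) :
    S.domRestrict (Submodule.span ℂ s) ≤ T := by
  have hW : Submodule.span ℂ s ≤ (S.graph ⊓ T.graph).map (LinearMap.fst ℂ E E) := by
    rw [Submodule.span_le]
    intro x hx
    obtain ⟨y, hy⟩ := h x hx
    exact ⟨(x, y), hy, rfl⟩
  rw [← LinearPMap.le_graph_iff]
  rintro ⟨x, y⟩ hxy
  have hS : (x, y) ∈ S.graph := LinearPMap.le_graph_of_le LinearPMap.domRestrict_le hxy
  have hx : x ∈ Submodule.span ℂ s := (LinearPMap.mem_domain_of_mem_graph hxy).1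
  obtain ⟨⟨x', y'⟩, ⟨h1, h2⟩, rfl⟩ := hW hx
  rwa [LinearPMap.mem_graph_snd_inj S hS h1 rfl]

end Abstract

/-- If an operator maps `c φₙ` to `d φₙ'` for two families of Hermite functions then it intertwines
the corresponding lowering operators. -/
theorem lowerS_mem_graph {T : L2 →ₗ.[ℂ] L2} {θ₁ θ₂ : ℝ} (h₁ : 0 < Real.cos (2 * θ₁))
    (h₂ : 0 < Real.cos (2 * θ₂)) {N₁ N₂ c d : ℂ}
    (h : ∀ n, (c • toL2 (phiS θ₁ N₁ n), d • toL2 (phiS θ₂ N₂ n)) ∈ T.graph) (n : ℕ) :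
    (c • toL2 (lowerS θ₁ (phiS θ₁ N₁ n)), d • toL2 (lowerS θ₂ (phiS θ₂ N₂ n))) ∈ T.graph := by
  cases n with
  | zero =>
    rw [lowerS_phiS_zero h₁, lowerS_phiS_zero h₂, map_zero, smul_zero, smul_zero]
    exact T.graph.zero_mem
  | succ n =>
    rw [lowerS_phiS_succ h₁, lowerS_phiS_succ h₂, map_smul, map_smul, smul_comm c, smul_comm d]
    exact T.graph.smul_mem _ (h n)

theorem raiseS_mem_graph {T : L2 →ₗ.[ℂ] L2} {θ₁ θ₂ : ℝ} (h₁ : 0 < Real.cos (2 * θ₁))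
    (h₂ : 0 < Real.cos (2 * θ₂)) {N₁ N₂ c d : ℂ}
    (h : ∀ n, (c • toL2 (phiS θ₁ N₁ n), d • toL2 (phiS θ₂ N₂ n)) ∈ T.graph) (n : ℕ) :
    (c • toL2 (raiseS θ₁ (phiS θ₁ N₁ n)), d • toL2 (raiseS θ₂ (phiS θ₂ N₂ n))) ∈ T.graph := by
  rw [raiseS_phiS h₁, raiseS_phiS h₂, map_smul, map_smul, smul_comm c, smul_comm d]
  exact T.graph.smul_mem _ (h (n + 1))

theorem lowerS_zero : lowerS 0 = ladder 1 1 := by simp [lowerS]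

theorem raiseS_zero : raiseS 0 = ladder 1 (-1) := by simp [raiseS]

theorem lowerS_eq (θ : ℝ) : lowerS θ =
    (Real.cos θ : ℂ) • lowerS 0 + (Complex.I * Real.sin θ) • raiseS 0 := by
  rw [lowerS_zero, raiseS_zero, smul_ladder, smul_ladder, ladder_add, lowerS, exp_I_mul,
    exp_neg_I_mul]
  congr 1 <;> ring

theorem raiseS_eq (θ : ℝ) : raiseS θ =
    (Real.cos θ : ℂ) • raiseS 0 + (Complex.I * Real.sin θ) • lowerS 0 := by
  rw [lowerS_zero, raiseS_zero, smul_ladder, smul_ladder, ladder_add, raiseS, exp_I_mul,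
    exp_neg_I_mul]
  congr 1 <;> ring

theorem cos_sq_add_sin_sq (θ : ℝ) : (Real.cos θ : ℂ) ^ 2 + (Real.sin θ : ℂ) ^ 2 = 1 := by
  exact_mod_cast Real.cos_sq_add_sin_sq θ

/-- `a` in terms of `A_{-θ}` and `B_{-θ}`, inverting `lowerS_eq`. -/
theorem lowerS_zero_eq (θ : ℝ) : lowerS 0 =
    (Real.cos θ : ℂ) • lowerS (-θ) + (Complex.I * Real.sin θ) • raiseS (-θ) := by
  rw [lowerS_eq (-θ), raiseS_eq (-θ), Real.cos_neg, Real.sin_neg, Complex.ofReal_neg]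
  have h := cos_sq_add_sin_sq θ
  have hI := Complex.I_mul_I
  generalize (Real.cos θ : ℂ) = c at *
  generalize (Real.sin θ : ℂ) = s at *
  match_scalars
  · linear_combination -h + s ^ 2 * hI
  · ring

theorem raiseS_zero_eq (θ : ℝ) : raiseS 0 =
    (Real.cos θ : ℂ) • raiseS (-θ) + (Complex.I * Real.sin θ) • lowerS (-θ) := by
  rw [lowerS_eq (-θ), raiseS_eq (-θ), Real.cos_neg, Real.sin_neg, Complex.ofReal_neg]
  have h := cos_sq_add_sin_sq θ
  have hI := Complex.I_mul_I
  generalize (Real.cos θ : ℂ) = c at *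
  generalize (Real.sin θ : ℂ) = s at *
  match_scalars
  · linear_combination -h + s ^ 2 * hI
  · ring

theorem mem_opa_graph (s : 𝓢(ℝ, ℂ)) : (toL2 s, toL2 (lowerS 0 s)) ∈ opa.graph := by
  rw [opa_eq, lowerS_zero]
  exact toL2_mem_ofSchwartz_graph _ s

theorem mem_opadag_graph (s : 𝓢(ℝ, ℂ)) : (toL2 s, toL2 (raiseS 0 s)) ∈ opadag.graph := by
  rw [raiseS_zero]
  exact ofSchwartz_le_iff.1 ofSchwartz_le_opadag s

/-- A raising relation `L fₙ = √(n + 1) fₙ₊₁` gives `Lⁿ f₀ = √(n!) fₙ`. -/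
theorem mem_opPow_graph_of_ladder {T : L2 →ₗ.[ℂ] L2} {L : 𝓢(ℝ, ℂ) →ₗ[ℂ] 𝓢(ℝ, ℂ)}
    (hT : ofSchwartz L ≤ T) {f : ℕ → 𝓢(ℝ, ℂ)}
    (hf : ∀ n : ℕ, L (f n) = (Real.sqrt (n + 1) : ℂ) • f (n + 1)) (n : ℕ) :
    (toL2 (f 0), (Real.sqrt n.factorial : ℂ) • toL2 (f n)) ∈ (opPow T n).graph := by
  have h := mem_opPow_graph_of_chain (K := T)
    (fun n => (Real.sqrt n.factorial : ℂ) • toL2 (f n)) (fun n => ?_) n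
  · simpa using h
  · have h1 := ofSchwartz_le_iff.1 hT ((Real.sqrt n.factorial : ℂ) • f n)
    have h2 : (Real.sqrt (n + 1).factorial : ℂ) = Real.sqrt n.factorial * Real.sqrt (n + 1) := by
      rw [← Complex.ofReal_mul, ← Real.sqrt_mul (by positivity)]
      congr 2
      push_cast [Nat.factorial_succ]
      ring
    rw [map_smul, map_smul, hf, map_smul, map_smul, smul_smul, ← h2] at h1
    exact h1

theorem cos_two_mul_pos {θ : ℝ} (hθ : |θ| < Real.pi / 4) : 0 < Real.cos (2 * θ) := by
  have h := abs_lt.1 hθ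
  exact Real.cos_pos_of_mem_Ioo ⟨by linarith, by linarith⟩

/-- `‖φₙ‖` is unbounded because `1 / cos 2θ > 1`. -/
theorem exists_lt_norm_phiS {θ : ℝ} (hθ : |θ| < Real.pi / 4) (hθ0 : θ ≠ 0) {N : ℂ}
    (h0 : toL2 (phiS θ N 0) ≠ 0) (C : ℝ) : ∃ n, C < ‖toL2 (phiS θ N n)‖ := by
  have hc := cos_two_mul_pos hθ
  refine exists_lt_norm_of_sq (exists_lt_of_legendre_recurrence hc ?_ ?_
    (norm_phiS_sq_recurrence_zero hc N) (norm_phiS_sq_recurrence hc N)) C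
  · have h := abs_lt.1 hθ
    refine lt_of_le_of_ne (Real.cos_le_one _) fun h1 => ?_
    rw [Real.cos_eq_one_iff_of_lt_of_lt (by linarith [Real.pi_pos]) (by linarith [Real.pi_pos])]
      at h1
    exact hθ0 (by linarith)
  · positivity

section Metric

variable {θ : ℝ} {N₁ N₂ : ℂ}

theorem toL2_phiS_angle_zero (M : ℂ) (n : ℕ) : toL2 (phiS 0 M n) =
    (M / (Real.sqrt (2 ^ n * n.factorial) : ℂ)) • toL2 (gaussS 1 (hermP 0 n)) := by
  have h : Complex.exp (2 * Complex.I * (0 : ℝ)) = 1 := by simp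
  rw [phiS, h, map_smul]

/-- `T_θ eₙ` is a fixed multiple of `φₙ`. -/
theorem mem_opT_graph_phiS (hθ : |θ| < Real.pi / 4) (hN : N₁ ≠ 0) {M : ℂ} (hM : M ≠ 0) (n : ℕ) :
    (toL2 (phiS 0 M n), (N₁ / (M * Complex.exp (Complex.I * θ / 2)))⁻¹ • toL2 (phiS θ N₁ n)) ∈
      (opT θ).graph := by
  have h := (opT θ).graph.smul_mem (M / (Real.sqrt (2 ^ n * n.factorial) : ℂ))
    (mem_opT_graph_dilGauss hθ (hermP 0 n))
  rw [dilGauss_hermP, Prod.smul_mk, ← toL2_phiS_angle_zero] at h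
  have h1 : (N₁ / (M * Complex.exp (Complex.I * θ / 2)))⁻¹ • toL2 (phiS θ N₁ n) =
      (M / (Real.sqrt (2 ^ n * n.factorial) : ℂ)) • toL2 (Complex.exp (Complex.I * θ / 2) •
        gaussS (Complex.exp (2 * Complex.I * θ)) (hermP θ n)) := by
    rw [phiS, map_smul, map_smul, smul_smul, smul_smul]
    congr 1
    field_simp
  rwa [h1]

/-- The `eₙ` span a core of `T_θ`, so that `T_θ` can be computed weakly on the `eₙ`. -/
theorem mem_opT_graph_of_inner (hθ : |θ| < Real.pi / 4) (hθ0 : θ ≠ 0) (hN : N₁ ≠ 0) {M : ℂ}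
    (hM : M ≠ 0) {g h : L2}
    (hgh : ∀ n, inner ℂ ((N₁ / (M * Complex.exp (Complex.I * θ / 2)))⁻¹ • toL2 (phiS θ N₁ n)) g =
      inner ℂ (toL2 (phiS 0 M n)) h) : (g, h) ∈ (opT θ).graph := by
  have hc := cos_two_mul_pos hθ
  refine mem_graph_of_inner_eq (opT_isClosed hθ) (opT_isFormalAdjoint hθ)
    (mem_opT_graph_dilGauss hθ)
    (fun _ hσ _ hg => eq_zero_of_inner_dilGauss_add hθ hθ0 hσ hg) fun P => ?_
  have hP : P ∈ Submodule.span ℂ (Set.range (hermP 0)) := by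
    rw [span_range_hermP]
    trivial
  have hsmul : ∀ (c : ℂ) (P : Polynomial ℂ),
      dilGauss (Complex.I * θ) (c • P) = c • dilGauss (Complex.I * θ) P := by
    intro c P
    rw [dilGauss, dilGauss, Polynomial.smul_comp, map_smul, smul_comm]
  induction hP using Submodule.span_induction with
  | mem P hP =>
    obtain ⟨n, rfl⟩ := hP
    have h1 := hgh n
    have h2 := mem_opT_graph_phiS hθ hN hM n
    have h3 := (opT θ).graph.smul_mem (M / (Real.sqrt (2 ^ n * n.factorial) : ℂ))
      (mem_opT_graph_dilGauss hθ (hermP 0 n))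
    rw [Prod.smul_mk, ← toL2_phiS_angle_zero] at h3
    rw [(opT θ).mem_graph_snd_inj h2 h3 rfl, toL2_phiS_angle_zero, inner_smul_left,
      inner_smul_left] at h1
    refine mul_left_cancel₀ ((map_ne_zero _).2 ?_) h1
    exact div_ne_zero hM (Complex.ofReal_ne_zero.2 (Real.sqrt_ne_zero'.2 (by positivity)))
  | zero =>
    have := hsmul 0 0
    rw [zero_smul, zero_smul] at this
    rw [this, map_zero, map_zero, map_zero, inner_zero_left, inner_zero_left]
  | add P Q _ _ hP hQ =>
    rw [dilGauss_add, map_add, map_add, map_add, inner_add_left, inner_add_left, hP, hQ]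
  | smul c P _ hP => rw [hsmul, map_smul, map_smul, map_smul, inner_smul_left, inner_smul_left, hP]

end Metric

end Swanson

end

open Swanson in
theorem mainTheorem4 (θ : ℝ) (hθ : θ ∈ Set.Ioo (-(Real.pi / 4)) (Real.pi / 4)) (hθ0 : θ ≠ 0)
    (N₁ N₂ : ℂ)
    (hN : (starRingEnd ℂ) N₁ * N₂ = Complex.exp (-(Complex.I * θ)) / (Real.sqrt Real.pi : ℂ)) :
    -- the commutation rule, as operators with the common domain `𝓢(ℝ)`
    Swanson.opMul (Swanson.opA θ) (Swanson.opB θ) - Swanson.opMul (Swanson.opB θ) (Swanson.opA θ)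
      = (LinearMap.id : Swanson.L2 →ₗ[ℂ] Swanson.L2).toPMap Swanson.schwartzSpace ∧
    -- factorization of the hamiltonian
    Swanson.opH θ = ((Real.cos (2 * θ) : ℂ)⁻¹) •
      (Swanson.opMul (Swanson.opB θ) (Swanson.opA θ) + (1 / 2 : ℂ) • Swanson.opOne) ∧
    -- coordinate expressions of `A_θ` and `B_θ`
    (∀ f g : SchwartzMap ℝ ℂ,
      (∀ x : ℝ, g x = ((Real.sqrt 2 : ℂ)⁻¹) * (Complex.exp (Complex.I * θ) * x * f x
        + Complex.exp (-(Complex.I * θ)) * deriv f x)) →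
      (Swanson.toL2 f, Swanson.toL2 g) ∈ (Swanson.opA θ).graph) ∧
    (∀ f g : SchwartzMap ℝ ℂ,
      (∀ x : ℝ, g x = ((Real.sqrt 2 : ℂ)⁻¹) * (Complex.exp (Complex.I * θ) * x * f x
        - Complex.exp (-(Complex.I * θ)) * deriv f x)) →
      (Swanson.toL2 f, Swanson.toL2 g) ∈ (Swanson.opB θ).graph) ∧
    -- the vectors `φ_n`, `Ψ_n` and the Hermite functions `e_n`, all of them Schwartz functions
    ∃ φs Ψs es : ℕ → SchwartzMap ℝ ℂ,
      (∀ n x, φs n x = Swanson.hermiteFun θ N₁ n x) ∧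
      (∀ n x, Ψs n x = Swanson.hermiteFun (-θ) N₂ n x) ∧
      (∀ n x, es n x = Swanson.hermiteFun 0 ((Real.pi ^ (-(1 / 4) : ℝ) : ℝ) : ℂ) n x) ∧
      ∃ φ Ψ e : ℕ → Swanson.L2,
        (∀ n, φ n = Swanson.toL2 (φs n)) ∧
        (∀ n, Ψ n = Swanson.toL2 (Ψs n)) ∧
        (∀ n, e n = Swanson.toL2 (es n)) ∧
        -- `e` is an orthonormal basis
        Orthonormal ℂ e ∧ Swanson.IsCompleteFamily e ∧
        -- vacua: `A φ₀ = 0` and `B† Ψ₀ = 0`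
        (φ 0, 0) ∈ (Swanson.opA θ).graph ∧
        (Ψ 0, 0) ∈ (Swanson.opB θ).adjoint.graph ∧
        -- `φ_n = Bⁿ φ₀ / √n!` and `Ψ_n = (A†)ⁿ Ψ₀ / √n!`
        (∀ n : ℕ, (φ 0, (Real.sqrt n.factorial : ℂ) • φ n)
          ∈ (Swanson.opPow (Swanson.opB θ) n).graph) ∧
        (∀ n : ℕ, (Ψ 0, (Real.sqrt n.factorial : ℂ) • Ψ n)
          ∈ (Swanson.opPow (Swanson.opA θ).adjoint n).graph) ∧
        -- `B A φ_n = n φ_n` and `A† B† Ψ_n = n Ψ_n`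
        (∀ n : ℕ, (φ n, (n : ℂ) • φ n)
          ∈ (Swanson.opMul (Swanson.opB θ) (Swanson.opA θ)).graph) ∧
        (∀ n : ℕ, (Ψ n, (n : ℂ) • Ψ n)
          ∈ (Swanson.opMul (Swanson.opA θ).adjoint (Swanson.opB θ).adjoint).graph) ∧
        -- the eigenvectors of `H_θ` and of its adjoint
        (∀ (E : ℂ) (f : Swanson.L2), f ≠ 0 →
          ((f, E • f) ∈ (Swanson.opH θ).graph ↔
            ∃ (n : ℕ) (c : ℂ), E = ((n : ℂ) + 1 / 2) / (Real.cos (2 * θ) : ℂ) ∧ f = c • φ n)) ∧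
        (∀ (E : ℂ) (f : Swanson.L2), f ≠ 0 →
          ((f, E • f) ∈ (Swanson.opH θ).adjoint.graph ↔
            ∃ (n : ℕ) (c : ℂ), E = ((n : ℂ) + 1 / 2) / (Real.cos (2 * θ) : ℂ) ∧ f = c • Ψ n)) ∧
        -- biorthogonality
        (∀ n m : ℕ, inner ℂ (φ n) (Ψ m) = if n = m then (1 : ℂ) else 0) ∧
        -- completeness
        Swanson.IsCompleteFamily φ ∧ Swanson.IsCompleteFamily Ψ ∧
        -- `T_θ` is self-adjoint, invertible and unbounded, with unbounded inverse
        IsSelfAdjoint (Swanson.opT θ) ∧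
        LinearMap.ker (Swanson.opT θ).toFun = ⊥ ∧
        Dense ((Swanson.opT θ).inverse.domain : Set Swanson.L2) ∧
        ¬ Swanson.IsBoundedOp (Swanson.opT θ) ∧
        ¬ Swanson.IsBoundedOp (Swanson.opT θ).inverse ∧
        -- `A_θ = T_θ a T_θ⁻¹` and `B_θ = T_θ a† T_θ⁻¹` on the span of the `e_n` and the `φ_n`
        (Swanson.opA θ).domRestrict (Submodule.span ℂ (Set.range e ∪ Set.range φ))
          ≤ Swanson.opMul (Swanson.opT θ)
              (Swanson.opMul Swanson.opa (Swanson.opT θ).inverse) ∧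
        (Swanson.opB θ).domRestrict (Submodule.span ℂ (Set.range e ∪ Set.range φ))
          ≤ Swanson.opMul (Swanson.opT θ)
              (Swanson.opMul Swanson.opadag (Swanson.opT θ).inverse) ∧
        -- `φ_n = α T_θ e_n` and `Ψ_n = (1 / conj α) T_θ⁻¹ e_n`
        (∃ α : ℂ, α ≠ 0 ∧
          (∀ n : ℕ, (e n, α⁻¹ • φ n) ∈ (Swanson.opT θ).graph) ∧
          (∀ n : ℕ, (e n, (starRingEnd ℂ) α • Ψ n) ∈ (Swanson.opT θ).inverse.graph)) ∧
        -- neither family is a Riesz basis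
        ¬ Swanson.IsRieszBasis φ ∧ ¬ Swanson.IsRieszBasis Ψ := by
  have hθa : |θ| < Real.pi / 4 := abs_lt.2 hθ
  have hc := cos_two_mul_pos hθa
  have hcn : 0 < Real.cos (2 * -θ) := by rwa [mul_neg, Real.cos_neg]
  have hc0 : 0 < Real.cos (2 * 0) := by simp
  have hcos : 0 < Real.cos θ := Real.cos_pos_of_mem_Ioo
    ⟨by linarith [hθ.1, Real.pi_pos], by linarith [hθ.2, Real.pi_pos]⟩
  have hpi : (Real.sqrt Real.pi : ℂ) ≠ 0 :=
    Complex.ofReal_ne_zero.2 (Real.sqrt_pos.2 Real.pi_pos).ne'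
  have hN0 : (starRingEnd ℂ) N₁ * N₂ ≠ 0 := by
    rw [hN]
    exact div_ne_zero (Complex.exp_ne_zero _) hpi
  have hN₁ : N₁ ≠ 0 := (map_ne_zero _).1 (left_ne_zero_of_mul hN0)
  have hN₂ : N₂ ≠ 0 := right_ne_zero_of_mul hN0
  set M : ℂ := ((Real.pi ^ (-(1 / 4) : ℝ) : ℝ) : ℂ) with hMdef
  have hM : M ≠ 0 := Complex.ofReal_ne_zero.2 (Real.rpow_pos_of_pos Real.pi_pos _).ne'
  have hMM : (starRingEnd ℂ) M * M =
      Complex.exp (-(Complex.I * (0 : ℝ))) / (Real.sqrt Real.pi : ℂ) := by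
    rw [hMdef, Complex.conj_ofReal, ← Complex.ofReal_mul, ← Real.rpow_add Real.pi_pos]
    norm_num
    rw [Real.sqrt_eq_rpow, ← Complex.ofReal_inv, ← Real.rpow_neg Real.pi_pos.le]
  have hbi := inner_phiS_phiS_neg hc hcos hN
  have hbi' : ∀ n m, inner ℂ (toL2 (phiS (-θ) N₂ n)) (toL2 (phiS θ N₁ m)) =
      if n = m then (1 : ℂ) else 0 := by
    intro n m
    rw [← inner_conj_symm, hbi m n]
    by_cases h : n = m
    · simp [h]
    · rw [if_neg h, if_neg (Ne.symm h), map_zero]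
  have hee : ∀ n m, inner ℂ (toL2 (phiS 0 M n)) (toL2 (phiS 0 M m)) =
      if n = m then (1 : ℂ) else 0 := by
    intro n m
    have h := inner_phiS_phiS_neg (θ := 0) hc0 (by simp) hMM n m
    rwa [neg_zero] at h
  have hon : Orthonormal ℂ (fun n => toL2 (phiS 0 M n)) := orthonormal_iff_ite.2 hee
  have hφ0 : toL2 (phiS θ N₁ 0) ≠ 0 := by
    intro h
    have := hbi 0 0
    rw [h, inner_zero_left] at this
    simp at this
  have hΨ0 : toL2 (phiS (-θ) N₂ 0) ≠ 0 := by
    intro h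
    have := hbi 0 0
    rw [h, inner_zero_right] at this
    simp at this
  have hφtot : ∀ g : L2, (∀ n, inner ℂ (toL2 (phiS θ N₁ n)) g = 0) → g = 0 :=
    fun g => eq_zero_of_inner_phiS hc hN₁
  have hΨtot : ∀ g : L2, (∀ n, inner ℂ (toL2 (phiS (-θ) N₂ n)) g = 0) → g = 0 :=
    fun g => eq_zero_of_inner_phiS hcn hN₂
  have hφun := exists_lt_norm_phiS hθa hθ0 hφ0
  have hΨun := exists_lt_norm_phiS (θ := -θ) (by rwa [abs_neg]) (neg_ne_zero.2 hθ0) hΨ0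
  -- the eigenvalues are real and pairwise distinct
  have hev : ∀ n : ℕ, (starRingEnd ℂ) (((n : ℂ) + 1 / 2) / (Real.cos (2 * θ) : ℂ)) =
      ((n : ℂ) + 1 / 2) / (Real.cos (2 * θ) : ℂ) := by
    intro n
    simp only [map_div₀, map_add, Complex.conj_natCast, map_one, Complex.conj_ofNat,
      Complex.conj_ofReal]
  have hevinj : Function.Injective
      (fun n : ℕ => ((n : ℂ) + 1 / 2) / (Real.cos (2 * θ) : ℂ)) := by
    intro n m h
    have h1 := (div_left_inj' (Complex.ofReal_ne_zero.2 hc.ne')).1 h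
    exact_mod_cast add_right_cancel h1
  have hH := opH_eq hc.ne'
  have hHφ : ∀ n, (toL2 (phiS θ N₁ n), (((n : ℂ) + 1 / 2) / (Real.cos (2 * θ) : ℂ)) •
      toL2 (phiS θ N₁ n)) ∈ (opH θ).graph := by
    intro n
    have h := toL2_mem_ofSchwartz_graph (hamS θ) (phiS θ N₁ n)
    rwa [hamS_phiS hc, map_smul, ← hH] at h
  have hHdense : Dense ((opH θ).domain : Set L2) := by
    rw [hH]
    exact ofSchwartz_domain_dense _
  have hHΨ : ∀ n, (toL2 (phiS (-θ) N₂ n), (((n : ℂ) + 1 / 2) / (Real.cos (2 * θ) : ℂ)) •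
      toL2 (phiS (-θ) N₂ n)) ∈ (opH θ).adjoint.graph := by
    intro n
    have h := ofSchwartz_le_iff.1 (ofSchwartz_le_adjoint (inner_hamS θ)) (phiS (-θ) N₂ n)
    rwa [hamS_phiS hcn, map_smul, ← hH, mul_neg, Real.cos_neg] at h
  -- `T_θ` on the three families; `T_θ Ψₙ` is determined weakly, by testing against the `eₘ`
  set α : ℂ := N₁ / (M * Complex.exp (Complex.I * θ / 2)) with hα
  have hα0 : α ≠ 0 := div_ne_zero hN₁ (mul_ne_zero hM (Complex.exp_ne_zero _))
  have hTe : ∀ n, (toL2 (phiS 0 M n), α⁻¹ • toL2 (phiS θ N₁ n)) ∈ (opT θ).graph :=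
    mem_opT_graph_phiS hθa hN₁ hM
  have hTΨ : ∀ n, ((starRingEnd ℂ) α • toL2 (phiS (-θ) N₂ n), toL2 (phiS 0 M n)) ∈
      (opT θ).graph := by
    intro n
    refine mem_opT_graph_of_inner hθa hθ0 hN₁ hM fun m => ?_
    rw [← hα, inner_smul_left, inner_smul_right, hbi, hee, ← mul_assoc, map_inv₀,
      inv_mul_cancel₀ ((map_ne_zero _).2 hα0), one_mul]
  have hTφ : ∀ n, (α • toL2 (phiS 0 M n), toL2 (phiS θ N₁ n)) ∈ (opT θ).graph := by
    intro n
    have h := (opT θ).graph.smul_mem α (hTe n)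
    rwa [Prod.smul_mk, smul_inv_smul₀ hα0] at h
  have hTs := opT_isFormalAdjoint hθa
  have hTker : LinearMap.ker (opT θ).toFun = ⊥ := by
    refine ker_eq_bot_of_graph fun x hx => hφtot x fun n => ?_
    rw [isFormalAdjoint_iff_graph.1 hTs _ _ _ _ (hTφ n) hx, inner_zero_right]
  have hinvφ : ∀ n, (toL2 (phiS θ N₁ n), α • toL2 (phiS 0 M n)) ∈ (opT θ).inverse.graph :=
    fun n => (mem_inverse_graph_iff hTker).2 (hTφ n)
  have hinve : ∀ n, (toL2 (phiS 0 M n), (starRingEnd ℂ) α • toL2 (phiS (-θ) N₂ n)) ∈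
      (opT θ).inverse.graph :=
    fun n => (mem_inverse_graph_iff hTker).2 (hTΨ n)
  -- `T_θ` intertwines the ladder operators of the three families
  have hTφ1 : ∀ n, (α • toL2 (phiS 0 M n), (1 : ℂ) • toL2 (phiS θ N₁ n)) ∈ (opT θ).graph := by
    intro n
    rw [one_smul]
    exact hTφ n
  have hTΨ1 : ∀ n, ((starRingEnd ℂ) α • toL2 (phiS (-θ) N₂ n), (1 : ℂ) • toL2 (phiS 0 M n)) ∈
      (opT θ).graph := by
    intro n
    rw [one_smul]
    exact hTΨ n
  have hφlow := lowerS_mem_graph hc0 hc hTφ1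
  have hφraise := raiseS_mem_graph hc0 hc hTφ1
  have hΨlow := lowerS_mem_graph hcn hc0 hTΨ1
  have hΨraise := raiseS_mem_graph hcn hc0 hTΨ1
  simp only [one_smul] at hφlow hφraise hΨlow hΨraise
  -- expanding `a` in `A_{-θ}, B_{-θ}` and `A_θ` in `a, a†` has the same coefficients, whence
  -- `T_θ a Ψₙ` is the same multiple of `A_θ eₙ` as `T_θ Ψₙ` is of `eₙ`
  have hΨa : ∀ n, ((starRingEnd ℂ) α • toL2 (lowerS 0 (phiS (-θ) N₂ n)),
      toL2 (lowerS θ (phiS 0 M n))) ∈ (opT θ).graph := by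
    intro n
    have h := (opT θ).graph.add_mem
      ((opT θ).graph.smul_mem (Real.cos θ : ℂ) (hΨlow n))
      ((opT θ).graph.smul_mem (Complex.I * Real.sin θ) (hΨraise n))
    have h1 := LinearMap.congr_fun (lowerS_zero_eq θ) (phiS (-θ) N₂ n)
    have h2 := LinearMap.congr_fun (lowerS_eq θ) (phiS 0 M n)
    simp only [LinearMap.add_apply, LinearMap.smul_apply] at h1 h2
    rw [h1, h2]
    simp only [map_add, map_smul, smul_add]
    rw [smul_comm ((starRingEnd ℂ) α), smul_comm ((starRingEnd ℂ) α)]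
    exact h
  have hΨadag : ∀ n, ((starRingEnd ℂ) α • toL2 (raiseS 0 (phiS (-θ) N₂ n)),
      toL2 (raiseS θ (phiS 0 M n))) ∈ (opT θ).graph := by
    intro n
    have h := (opT θ).graph.add_mem
      ((opT θ).graph.smul_mem (Real.cos θ : ℂ) (hΨraise n))
      ((opT θ).graph.smul_mem (Complex.I * Real.sin θ) (hΨlow n))
    have h1 := LinearMap.congr_fun (raiseS_zero_eq θ) (phiS (-θ) N₂ n)
    have h2 := LinearMap.congr_fun (raiseS_eq θ) (phiS 0 M n)
    simp only [LinearMap.add_apply, LinearMap.smul_apply] at h1 h2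
    rw [h1, h2]
    simp only [map_add, map_smul, smul_add]
    rw [smul_comm ((starRingEnd ℂ) α), smul_comm ((starRingEnd ℂ) α)]
    exact h
  have hA : ∀ s, (toL2 s, toL2 (lowerS θ s)) ∈ (opA θ).graph := by
    intro s
    rw [opA_eq]
    exact toL2_mem_ofSchwartz_graph _ s
  have hB : ∀ s, (toL2 s, toL2 (raiseS θ s)) ∈ (opB θ).graph := by
    intro s
    rw [opB_eq]
    exact toL2_mem_ofSchwartz_graph _ s
  refine ⟨opA_opB_commutator θ, ?_, ?_, ?_, fun n => phiS θ N₁ n, fun n => phiS (-θ) N₂ n,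
    fun n => phiS 0 M n, fun n x => phiS_apply hc _ _ _, fun n x => phiS_apply hcn _ _ _,
    fun n x => phiS_apply hc0 _ _ _, _, _, _, fun n => rfl, fun n => rfl, fun n => rfl,
    hon, isCompleteFamily_of_inner fun g => eq_zero_of_inner_phiS hc0 hM, ?_, ?_, ?_, ?_, ?_, ?_,
    ?_, ?_, hbi, isCompleteFamily_of_inner hφtot, isCompleteFamily_of_inner hΨtot,
    opT_isSelfAdjoint hθa hθ0, hTker, ?_, ?_, ?_, ?_, ?_, ⟨α, hα0, hTe, hinve⟩,
    not_isRieszBasis_of_norm_unbounded hφun, not_isRieszBasis_of_norm_unbounded hΨun⟩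
  · rw [hH, cos_two_mul_smul_opMul_add]
  · intro f g hfg
    have h : g = lowerS θ f := by
      ext x
      simp only [hfg, lowerS, ladder_apply, smul_apply, add_apply, mulX_apply, derivS_apply,
        smul_eq_mul]
      ring
    rw [h]
    exact hA f
  · intro f g hfg
    have h : g = raiseS θ f := by
      ext x
      simp only [hfg, raiseS, ladder_apply, smul_apply, add_apply, mulX_apply, derivS_apply,
        smul_eq_mul]
      ring
    rw [h]
    exact hB f
  · have h := hA (phiS θ N₁ 0)
    rwa [lowerS_phiS_zero hc, map_zero] at h
  · have h := ofSchwartz_le_iff.1 (ofSchwartz_le_opB_adjoint θ) (phiS (-θ) N₂ 0)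
    rwa [lowerS_phiS_zero hcn, map_zero] at h
  · exact mem_opPow_graph_of_ladder (opB_eq θ).ge (raiseS_phiS hc N₁)
  · exact mem_opPow_graph_of_ladder (ofSchwartz_le_opA_adjoint θ) (raiseS_phiS hcn N₂)
  · intro n
    refine mem_opMul_graph.2 ⟨_, hA _, ?_⟩
    have h := hB (lowerS θ (phiS θ N₁ n))
    rwa [raiseS_lowerS_phiS hc, map_smul] at h
  · intro n
    refine mem_opMul_graph.2 ⟨_, ofSchwartz_le_iff.1 (ofSchwartz_le_opB_adjoint θ) _, ?_⟩
    have h := ofSchwartz_le_iff.1 (ofSchwartz_le_opA_adjoint θ) (lowerS (-θ) (phiS (-θ) N₂ n))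
    rwa [raiseS_lowerS_phiS hcn, map_smul] at h
  · refine fun E f hf => mem_graph_smul_iff_of_biorthogonal hHφ (fun n f h hfh => ?_) hbi' hevinj
      hΨtot E hf
    have h1 := (mem_adjoint_graph_iff hHdense).1 (hHΨ n) _ _ hfh
    rw [← inner_conj_symm, h1, inner_smul_right, map_mul, hev, inner_conj_symm]
  · refine fun E f hf => mem_graph_smul_iff_of_biorthogonal hHΨ (fun n f h hfh => ?_) hbi hevinj
      hφtot E hf
    have h1 := (mem_adjoint_graph_iff hHdense).1 hfh _ _ (hHφ n)
    rw [← h1, inner_smul_left, hev]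
  · refine Dense.mono ?_ (isCompleteFamily_of_inner hφtot)
    rw [SetLike.coe_subset_coe, Submodule.span_le]
    rintro _ ⟨n, rfl⟩
    exact LinearPMap.mem_domain_of_mem_graph (hinvφ n)
  · exact not_isBoundedOp_of_norm_unbounded hTe hon.1
      (exists_lt_norm_smul hφun (inv_ne_zero hα0))
  · exact not_isBoundedOp_of_norm_unbounded hinve hon.1
      (exists_lt_norm_smul hΨun ((map_ne_zero _).2 hα0))
  · refine domRestrict_span_le ?_
    rintro _ (⟨n, rfl⟩ | ⟨n, rfl⟩)
    · exact ⟨_, hA _, mem_opMul_graph.2 ⟨_, mem_opMul_graph.2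
        ⟨_, hinve n, opa.graph.smul_mem _ (mem_opa_graph _)⟩, hΨa n⟩⟩
    · exact ⟨_, hA _, mem_opMul_graph.2 ⟨_, mem_opMul_graph.2
        ⟨_, hinvφ n, opa.graph.smul_mem _ (mem_opa_graph _)⟩, hφlow n⟩⟩
  · refine domRestrict_span_le ?_
    rintro _ (⟨n, rfl⟩ | ⟨n, rfl⟩)
    · exact ⟨_, hB _, mem_opMul_graph.2 ⟨_, mem_opMul_graph.2
        ⟨_, hinve n, opadag.graph.smul_mem _ (mem_opadag_graph _)⟩, hΨadag n⟩⟩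
    · exact ⟨_, hB _, mem_opMul_graph.2 ⟨_, mem_opMul_graph.2
        ⟨_, hinvφ n, opadag.graph.smul_mem _ (mem_opadag_graph _)⟩, hφraise n⟩⟩
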